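/- Let $\mathbb K$ be a field, $H$ a Hopf algebra over $\mathbb K$ with coproduct $h\mapsto\sum h_{(1)}\otimes h_{(2)}$ and counit $\varepsilon_H$. An object of ${}^H_H\mathcal{YD}$ (a Yetter–Drinfeld module over $H$) is a $\mathbb K$-vector space $V$ with a left $H$-module structure $\cdot$ and a left $H$-comodule structure $v\mapsto\sum v_{(-1)}\otimes v_{(0)}$ such that $\sum h_{(1)}v_{(-1)}\otimes h_{(2)}\cdot v_{(0)}=\sum (h_{(1)}\cdot v)_{(-1)}h_{(2)}\otimes (h_{(1)}\cdot v)_{(0)}$ for all $h\in H$, $v\in V$; morphisms are linear maps that are module and comodule homomorphisms. The ground field is an object by $h\cdot c=\varepsilon_H(h)c$, $c\mapsto 1\otimes c$, and a tensor product $V\otimes W$ carries the diagonal structures $h\cdot(v\otimes w)=\sum h_{(1)}\cdot v\otimes h_{(2)}\cdot w$ and $v\otimes w\mapsto\sum v_{(-1)}w_{(-1)}\otimes (v_{(0)}\otimes w_{(0)})$; in this way $H$ acts and coacts on every $V^{\otimes n}$ and on $T(V)=\bigoplus_{n\ge 0}V^{\otimes n}$. The natural braiding of $V$ is $\sigma(v\otimes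 w)=\sum v_{(-1)}\cdot w\otimes v_{(0)}$. An algebra in ${}^H_H\mathcal{YD}$ is an object $A$ together with an associative (not necessarily unital) multiplication $A\otimes A\to A$ that is a morphism in ${}^H_H\mathcal{YD}$. Put $\sigma_a=\mathrm{id}^{\otimes a-1}\otimes\sigma\otimes\mathrm{id}^{\otimes n-a-1}$ on $V^{\otimes n}$. Write $\underline\otimes$ for the tensor product between two copies of $T(V)$. Let $\beta:T(V)\underline\otimes T(V)\to T(V)\underline\otimes T(V)$ be the map whose restriction $\beta_{ij}:V^{\otimes i}\underline\otimes V^{\otimes j}\to V^{\otimes j}\underline\otimes V^{\otimes i}$ is $\sigma_{a_1}\cdots\sigma_{a_l}$, where $s_{a_1}\cdots s_{a_l}$ is a reduced expression of the permutation $\chi_{ij}\in\mathfrak S_{i+j}$ with $\chi_{ij}(k)=j+k$ for $k\le i$ and $\chi_{ij}(i+k)=k$ for $k\le j$ (so $\beta_{0i}$ and $\beta_{i0}$ are identities). Let $\delta(v_1\otimes\cdots\otimes v_n)=\sum_{i=0}^n (v_1\otimes\cdots\otimes v_i)\underline\otimes(v_{i+1}\otimes\cdots\otimes v_n)$, let $\varepsilon:T(V)\to\mathbb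 K$ be the projection, and let $\triangle_\beta=(\mathrm{id}\otimes\beta\otimes\mathrm{id})(\delta\otimes\delta)$, with iterates $\triangle_\beta^{(0)}=\mathrm{id}$, $\triangle_\beta^{(n+1)}=(\triangle_\beta^{(n)}\otimes\mathrm{id})\triangle_\beta$. A quantum multi-brace algebra structure on $(V,\sigma)$ is a family $M=\{M_{pq}\}_{p,q\ge0}$ of linear maps $M_{pq}:V^{\otimes p}\underline\otimes V^{\otimes q}\to V$, regarded together as one map $M:T(V)\underline\otimes T(V)\to V$, such that (i) $M_{00}=0$, $M_{10}=\mathrm{id}_V=M_{01}$, and $M_{n0}=0=M_{0n}$ for $n\ge2$; (ii) for all $i,j,k\ge1$: $\beta_{1k}(M_{ij}\otimes\mathrm{id}_V^{\otimes k})=(\mathrm{id}_V^{\otimes k}\otimes M_{ij})\beta_{i+j,k}$ and $\beta_{i1}(\mathrm{id}_V^{\otimes i}\otimes M_{jk})=(M_{jk}\otimes\mathrm{id}_V^{\otimes i})\beta_{i,j+k}$; (iii) for all $i,j,k\ge1$, on $V^{\otimes i}\underline\otimes V^{\otimes j}\underline\otimes V^{\otimes k}$: $\sum_{r=1}^{i+j}M_{rk}\circ\big((M^{\otimes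 r}\circ\triangle_\beta^{(r-1)})\otimes\mathrm{id}_V^{\otimes k}\big)=\sum_{l=1}^{j+k}M_{il}\circ\big(\mathrm{id}_V^{\otimes i}\otimes(M^{\otimes l}\circ\triangle_\beta^{(l-1)})\big)$. Given such an $M$, define $\ast=(\varepsilon\otimes\varepsilon)+\sum_{n\ge1}M^{\otimes n}\circ\triangle_\beta^{(n-1)}:T(V)\underline\otimes T(V)\to T(V)$ (on each element only finitely many terms are nonzero). **Proposition 3.7.** Let $V$ be an object of ${}^H_H\mathcal{YD}$ with natural braiding $\sigma$. If $M$ is a quantum multi-brace algebra structure on $(V,\sigma)$ such that every $M_{pq}$ is a morphism in ${}^H_H\mathcal{YD}$, then $(T(V),\ast)$, with the diagonal $H$-module and $H$-comodule structures, is an algebra in ${}^H_H\mathcal{YD}$. -/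

import Mathlib

open scoped TensorProduct DirectSum

noncomputable section

namespace QMB

/-! ### Modules and comodules over a Hopf algebra -/

section HopfModules

variable (K : Type*) (H : Type*) [Field K] [Ring H] [HopfAlgebra K H]

/-- The data of an action `H ⊗ X → X` and of a coaction `X → H ⊗ X` on a vector space `X`;
the axioms are collected in `IsYetterDrinfeld`. -/
structure ActCoact (X : Type*) [AddCommMonoid X] [Module K X] where
  act : H ⊗[K] X →ₗ[K] X
  coact : X →ₗ[K] H ⊗[K] X

variable {K H}
variable {X Y : Type*} [AddCommMonoid X] [Module K X] [AddCommMonoid Y] [Module K Y]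

/-- `X` is an object of the category of (left-left) Yetter-Drinfeld modules over `H`. -/
structure IsYetterDrinfeld (D : ActCoact K H X) : Prop where
  one_act : ∀ x : X, D.act (1 ⊗ₜ x) = x
  mul_act : ∀ (g h : H) (x : X), D.act ((g * h) ⊗ₜ x) = D.act (g ⊗ₜ D.act (h ⊗ₜ x))
  /-- `ε(x₍₋₁₎) x₍₀₎ = x` -/
  counit_coact :
    (TensorProduct.lid K X).toLinearMap ∘ₗ
      (Coalgebra.counit (R := K) (A := H)).rTensor X ∘ₗ D.coact = LinearMap.id
  /-- `x₍₋₁₎ ⊗ (x₍₀₎)₍₋₁₎ ⊗ (x₍₀₎)₍₀₎ = (x₍₋₁₎)₍₁₎ ⊗ (x₍₋₁₎)₍₂₎ ⊗ x₍₀₎` -/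
  coassoc :
    D.coact.lTensor H ∘ₗ D.coact =
      (TensorProduct.assoc K H H X).toLinearMap ∘ₗ
        (Coalgebra.comul (R := K) (A := H)).rTensor X ∘ₗ D.coact
  /-- `h₍₁₎ x₍₋₁₎ ⊗ h₍₂₎ · x₍₀₎ = (h₍₁₎ · x)₍₋₁₎ h₍₂₎ ⊗ (h₍₁₎ · x)₍₀₎` -/
  compat :
    TensorProduct.map (LinearMap.mul' K H) D.act ∘ₗ
        (TensorProduct.tensorTensorTensorComm K H H H X).toLinearMap ∘ₗ
        TensorProduct.map (Coalgebra.comul (R := K) (A := H)) D.coact =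
      (LinearMap.mul' K H).rTensor X ∘ₗ
        (TensorProduct.rightComm K H X H).toLinearMap ∘ₗ
        (D.coact ∘ₗ D.act).rTensor H ∘ₗ
        (TensorProduct.rightComm K H H X).toLinearMap ∘ₗ
        (Coalgebra.comul (R := K) (A := H)).rTensor X

/-- Linear maps that are module and comodule homomorphisms. -/
structure IsMorphism (D : ActCoact K H X) (E : ActCoact K H Y) (f : X →ₗ[K] Y) : Prop where
  map_act : f ∘ₗ D.act = E.act ∘ₗ f.lTensor H
  map_coact : E.coact ∘ₗ f = f.lTensor H ∘ₗ D.coact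

/-- The trivial structure on the ground field: `h · c = ε(h) c`, `c ↦ 1 ⊗ c`. -/
def ActCoact.unit : ActCoact K H K where
  act := (TensorProduct.lid K K).toLinearMap ∘ₗ
    (Coalgebra.counit (R := K) (A := H)).rTensor K
  coact := TensorProduct.mk K H K 1

/-- The diagonal structure on `X ⊗ Y`: `h · (x ⊗ y) = h₍₁₎ · x ⊗ h₍₂₎ · y` and
`x ⊗ y ↦ x₍₋₁₎ y₍₋₁₎ ⊗ (x₍₀₎ ⊗ y₍₀₎)`. -/
def ActCoact.tensor (D : ActCoact K H X) (E : ActCoact K H Y) : ActCoact K H (X ⊗[K] Y) where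
  act := TensorProduct.map D.act E.act ∘ₗ
    (TensorProduct.tensorTensorTensorComm K H H X Y).toLinearMap ∘ₗ
    (Coalgebra.comul (R := K) (A := H)).rTensor (X ⊗[K] Y)
  coact := (LinearMap.mul' K H).rTensor (X ⊗[K] Y) ∘ₗ
    (TensorProduct.tensorTensorTensorComm K H X H Y).toLinearMap ∘ₗ
    TensorProduct.map D.coact E.coact

/-- Transport of structure along a linear isomorphism. -/
def ActCoact.transport (D : ActCoact K H X) (e : X ≃ₗ[K] Y) : ActCoact K H Y where
  act := e.toLinearMap ∘ₗ D.act ∘ₗ e.symm.toLinearMap.lTensor H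
  coact := e.toLinearMap.lTensor H ∘ₗ D.coact ∘ₗ e.symm.toLinearMap

/-- The structure on a direct sum for which every summand is stable. -/
def ActCoact.directSum {A : ℕ → Type*} [∀ n, AddCommMonoid (A n)] [∀ n, Module K (A n)]
    (D : ∀ n, ActCoact K H (A n)) : ActCoact K H (⨁ n, A n) where
  act := TensorProduct.lift (LinearMap.flip (DirectSum.toModule K ℕ _ fun n =>
    LinearMap.flip (TensorProduct.curry (DirectSum.lof K ℕ A n ∘ₗ (D n).act))))
  coact := DirectSum.toModule K ℕ _ fun n => (DirectSum.lof K ℕ A n).lTensor H ∘ₗ (D n).coact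

/-- The natural braiding `x ⊗ y ↦ x₍₋₁₎ · y ⊗ x₍₀₎`. -/
def naturalBraiding (D : ActCoact K H X) : X ⊗[K] X →ₗ[K] X ⊗[K] X :=
  D.act.rTensor X ∘ₗ (TensorProduct.rightComm K H X X).toLinearMap ∘ₗ D.coact.rTensor X

/-- An algebra in the category of Yetter-Drinfeld modules: an object together with an
associative multiplication which is a morphism (algebras need not be unital). -/
structure IsYDAlgebra (D : ActCoact K H X) (m : X ⊗[K] X →ₗ[K] X) : Prop where
  isYetterDrinfeld : IsYetterDrinfeld D
  assoc : ∀ x y z : X, m (m (x ⊗ₜ y) ⊗ₜ z) = m (x ⊗ₜ m (y ⊗ₜ z))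
  isMorphism : IsMorphism (D.tensor D) D m

end HopfModules

/-! ### The tensor space and its maps -/

section TensorSpace

variable (K : Type*) (V : Type*) [Field K] [AddCommMonoid V] [Module K V]

/-- The vector space `T(V) = ⨁ₙ V^{⊗ n}`. -/
abbrev TensorSpace : Type _ := ⨁ n : ℕ, ⨂[K]^n V

/-- The inclusion of `V^{⊗ n}` into `T(V)`. -/
abbrev incl (n : ℕ) : ⨂[K]^n V →ₗ[K] TensorSpace K V :=
  DirectSum.lof K ℕ (fun n => ⨂[K]^n V) n

/-- The inclusion of `V^{⊗ i} ⊗ V^{⊗ j}` into `T(V) ⊗ T(V)`. -/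
abbrev incl₂ (i j : ℕ) :
    ⨂[K]^i V ⊗[K] ⨂[K]^j V →ₗ[K] TensorSpace K V ⊗[K] TensorSpace K V :=
  TensorProduct.map (incl K V i) (incl K V j)

/-- The canonical identification `V^{⊗ 1} = V`. -/
def powOne : ⨂[K]^1 V ≃ₗ[K] V := PiTensorProduct.subsingletonEquiv (0 : Fin 1)

/-- The canonical identification `V^{⊗ n} = V^{⊗ i} ⊗ V^{⊗ j}` for `i + j = n`. -/
def split {n i j : ℕ} (h : i + j = n) : ⨂[K]^n V ≃ₗ[K] ⨂[K]^i V ⊗[K] ⨂[K]^j V :=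
  (TensorPower.cast K V h.symm).trans TensorPower.mulEquiv.symm

variable {K V}

theorem powOne_tprod (v : Fin 1 → V) : powOne K V (PiTensorProduct.tprod K v) = v 0 :=
  PiTensorProduct.subsingletonEquiv_apply_tprod ..

theorem split_symm_tprod {n i j : ℕ} (h : i + j = n) (v : Fin i → V) (w : Fin j → V) :
    (split K V h).symm (PiTensorProduct.tprod K v ⊗ₜ PiTensorProduct.tprod K w) =
      PiTensorProduct.tprod K (Fin.append v w ∘ Fin.cast h.symm) := by
  have := TensorPower.tprod_mul_tprod K v w
  rw [TensorPower.gMul_def] at this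
  simp [split, this, TensorPower.cast_tprod]

/-- The linear map `T(V) ⊗ T(V) → X` with given components `V^{⊗ i} ⊗ V^{⊗ j} → X`. -/
def ofComponents {X : Type*} [AddCommMonoid X] [Module K X]
    (f : ∀ i j : ℕ, ⨂[K]^i V ⊗[K] ⨂[K]^j V →ₗ[K] X) :
    TensorSpace K V ⊗[K] TensorSpace K V →ₗ[K] X :=
  TensorProduct.lift (DirectSum.toModule K ℕ _ fun i =>
    LinearMap.flip (DirectSum.toModule K ℕ _ fun j =>
      LinearMap.flip (TensorProduct.curry (f i j))))

theorem ofComponents_incl₂ {X : Type*} [AddCommMonoid X] [Module K X]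
    (f : ∀ i j : ℕ, ⨂[K]^i V ⊗[K] ⨂[K]^j V →ₗ[K] X) (i j : ℕ) :
    ofComponents f ∘ₗ incl₂ K V i j = f i j := by
  refine TensorProduct.ext' fun x y => ?_
  simp only [ofComponents, LinearMap.comp_apply, TensorProduct.map_tmul, TensorProduct.lift.tmul,
    DirectSum.toModule_lof, LinearMap.flip_apply, TensorProduct.curry_apply]

/-- The operator `σ` on `V^{⊗ 2}`. -/
def sigmaTwo (σ : V ⊗[K] V →ₗ[K] V ⊗[K] V) : ⨂[K]^2 V →ₗ[K] ⨂[K]^2 V :=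
  let e : ⨂[K]^2 V ≃ₗ[K] V ⊗[K] V :=
    (split K V (i := 1) (j := 1) rfl).trans
      (TensorProduct.congr (powOne K V) (powOne K V))
  e.symm.toLinearMap ∘ₗ σ ∘ₗ e.toLinearMap

/-- The operator `id^{⊗ a} ⊗ σ ⊗ id^{⊗ (n - a - 2)}` on `V^{⊗ n}`, for `a + 1 < n`. Tensor slots
are counted from `0`, so this is the operator usually called `σ_{a+1}`. (For other `a` the value
is irrelevant, and set to be the identity.) -/
def sigmaAt (σ : V ⊗[K] V →ₗ[K] V ⊗[K] V) (n a : ℕ) : Module.End K (⨂[K]^n V) :=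
  if h : a + 1 < n then
    let e : ⨂[K]^n V ≃ₗ[K] ⨂[K]^a V ⊗[K] (⨂[K]^2 V ⊗[K] ⨂[K]^(n - a - 2) V) :=
      (split K V (i := a) (j := n - a) (by omega)).trans
        (TensorProduct.congr (LinearEquiv.refl K _)
          (split K V (i := 2) (j := n - a - 2) (by omega)))
    e.symm.toLinearMap ∘ₗ ((sigmaTwo σ).rTensor _).lTensor _ ∘ₗ e.toLinearMap
  else LinearMap.id

/-- A reduced word for the permutation `χ_{ij}`; the letter `a` stands for the transposition of
`a` and `a + 1` (counting from `0`). The word is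
`(s_{j-1} s_j ⋯ s_{i+j-2}) ⋯ (s_1 ⋯ s_i) (s_0 ⋯ s_{i-1})`. -/
def chiWord (i : ℕ) : ℕ → List ℕ
  | 0 => []
  | j + 1 => (List.range i).map (fun a => j + a) ++ chiWord i j

/-- The permutation of `ℕ` that a word in the adjacent transpositions stands for. -/
def wordPerm (w : List ℕ) : Equiv.Perm ℕ := (w.map fun a => Equiv.swap a (a + 1)).prod

/-- `T^σ_w` for a word `w = s_{a₁} ⋯ s_{aₗ}`: the operator `σ_{a₁} ⋯ σ_{aₗ}` on `V^{⊗ n}`. -/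
def wordOp (σ : V ⊗[K] V →ₗ[K] V ⊗[K] V) (n : ℕ) (w : List ℕ) : Module.End K (⨂[K]^n V) :=
  (w.map (sigmaAt σ n)).prod

/-- `β_{ij} = T^σ_{χ_{ij}} : V^{⊗ i} ⊗ V^{⊗ j} → V^{⊗ j} ⊗ V^{⊗ i}`. -/
def betaComp (σ : V ⊗[K] V →ₗ[K] V ⊗[K] V) (i j : ℕ) :
    ⨂[K]^i V ⊗[K] ⨂[K]^j V →ₗ[K] ⨂[K]^j V ⊗[K] ⨂[K]^i V :=
  (split K V (n := i + j) (add_comm j i)).toLinearMap ∘ₗ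
    wordOp σ (i + j) (chiWord i j) ∘ₗ (split K V (n := i + j) rfl).symm.toLinearMap

/-- The map `β : T(V) ⊗ T(V) → T(V) ⊗ T(V)`. -/
def beta (σ : V ⊗[K] V →ₗ[K] V ⊗[K] V) :
    TensorSpace K V ⊗[K] TensorSpace K V →ₗ[K] TensorSpace K V ⊗[K] TensorSpace K V :=
  ofComponents fun i j => incl₂ K V j i ∘ₗ betaComp σ i j

variable (K V) in
/-- The deconcatenation coproduct `δ` on `T(V)`. -/
def deconcat : TensorSpace K V →ₗ[K] TensorSpace K V ⊗[K] TensorSpace K V :=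
  DirectSum.toModule K ℕ _ fun n =>
    ∑ i : Fin (n + 1), incl₂ K V i (n - i) ∘ₗ
      (split K V (i := (i : ℕ)) (j := n - i) (by omega)).toLinearMap

variable (K V) in
/-- The projection `ε` of `T(V)` onto `K = V^{⊗ 0}`. -/
def counit : TensorSpace K V →ₗ[K] K :=
  (PiTensorProduct.isEmptyEquiv (Fin 0)).toLinearMap ∘ₗ
    DirectSum.component K ℕ (fun n => ⨂[K]^n V) 0

variable (K V) in
/-- The inclusion of `K = V^{⊗ 0}` into `T(V)`. -/
def unitMap : K →ₗ[K] TensorSpace K V :=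
  incl K V 0 ∘ₗ (PiTensorProduct.isEmptyEquiv (Fin 0)).symm.toLinearMap

variable (K V) in
/-- `ε ⊗ ε`, as a map `T(V) ⊗ T(V) → K ⊆ T(V)`. -/
def counitTensor : TensorSpace K V ⊗[K] TensorSpace K V →ₗ[K] TensorSpace K V :=
  unitMap K V ∘ₗ (TensorProduct.lid K K).toLinearMap ∘ₗ
    TensorProduct.map (counit K V) (counit K V)

/-- The regrouping `(A ⊗ B) ⊗ (C ⊗ D) = A ⊗ ((B ⊗ C) ⊗ D)`. -/
def regroup (A B C D : Type*) [AddCommMonoid A] [AddCommMonoid B] [AddCommMonoid C]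
    [AddCommMonoid D] [Module K A] [Module K B] [Module K C] [Module K D] :
    (A ⊗[K] B) ⊗[K] (C ⊗[K] D) ≃ₗ[K] A ⊗[K] ((B ⊗[K] C) ⊗[K] D) :=
  (TensorProduct.assoc K A B (C ⊗[K] D)).trans
    (TensorProduct.congr (LinearEquiv.refl K A) (TensorProduct.assoc K B C D).symm)

/-- The coproduct `△_β = (id ⊗ β ⊗ id) ∘ (δ ⊗ δ)` on `T(V) ⊗ T(V)`. -/
def comulBeta (σ : V ⊗[K] V →ₗ[K] V ⊗[K] V) :
    TensorSpace K V ⊗[K] TensorSpace K V →ₗ[K]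
      (TensorSpace K V ⊗[K] TensorSpace K V) ⊗[K] (TensorSpace K V ⊗[K] TensorSpace K V) :=
  (regroup (K := K) _ _ _ _).symm.toLinearMap ∘ₗ
    ((beta σ).rTensor (TensorSpace K V)).lTensor (TensorSpace K V) ∘ₗ
    (regroup (K := K) _ _ _ _).toLinearMap ∘ₗ
    TensorProduct.map (deconcat K V) (deconcat K V)

/-- The iterated coproduct `Δ^{(n)} : C → C^{⊗ (n+1)}`, where `Δ^{(0)} = id` and
`Δ^{(n+1)} = (Δ^{(n)} ⊗ id) ∘ Δ`. -/
def iterComul {C : Type*} [AddCommMonoid C] [Module K C] (Δ : C →ₗ[K] C ⊗[K] C) :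
    (n : ℕ) → C →ₗ[K] ⨂[K]^(n + 1) C
  | 0 => (powOne K C).symm.toLinearMap
  | n + 1 => (split K C (n := n + 1 + 1) (i := n + 1) (j := 1) rfl).symm.toLinearMap ∘ₗ
      TensorProduct.map (iterComul Δ n) (powOne K C).symm.toLinearMap ∘ₗ Δ

/-- A family of operations `M_{pq} : V^{⊗ p} ⊗ V^{⊗ q} → V`. -/
abbrev Operations (K : Type*) (V : Type*) [Field K] [AddCommMonoid V] [Module K V] : Type _ :=
  ∀ p q : ℕ, ⨂[K]^p V ⊗[K] ⨂[K]^q V →ₗ[K] V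

/-- `M^{⊗ (n+1)} ∘ △_β^{(n)} : T(V) ⊗ T(V) → V^{⊗ (n+1)}`, where `M = ⨁ M_{pq}`. -/
def opPow (σ : V ⊗[K] V →ₗ[K] V ⊗[K] V) (M : Operations K V) (n : ℕ) :
    TensorSpace K V ⊗[K] TensorSpace K V →ₗ[K] ⨂[K]^(n + 1) V :=
  PiTensorProduct.map (fun _ : Fin (n + 1) => ofComponents M) ∘ₗ iterComul (comulBeta σ) n

/-- The product `∗ = ε ⊗ ε + ∑_{n ≥ 1} M^{⊗ n} ∘ △_β^{(n-1)}` on `T(V)`. On `V^{⊗ i} ⊗ V^{⊗ j}`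
the terms with `n > i + j` vanish because `M_{00} = 0`, see `star_eq_sum`; the index below is
`n - 1`. -/
def star (σ : V ⊗[K] V →ₗ[K] V ⊗[K] V) (M : Operations K V) :
    TensorSpace K V ⊗[K] TensorSpace K V →ₗ[K] TensorSpace K V :=
  ofComponents fun i j =>
    (counitTensor K V + ∑ n ∈ Finset.range (i + j), incl K V (n + 1) ∘ₗ opPow σ M n) ∘ₗ
      incl₂ K V i j

/-- The conditions (i), (ii), (iii) under which a family of operations `M` on a vector space `V`
with a braiding `σ` is a quantum multi-brace algebra structure on `(V, σ)`. In (ii), `V` is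
identified with `V^{⊗ 1}`. -/
structure IsQuantumMultiBrace (σ : V ⊗[K] V →ₗ[K] V ⊗[K] V) (M : Operations K V) : Prop where
  zero_zero : M 0 0 = 0
  one_zero : ∀ (v : Fin 1 → V) (w : Fin 0 → V),
    M 1 0 (PiTensorProduct.tprod K v ⊗ₜ PiTensorProduct.tprod K w) = v 0
  zero_one : ∀ (w : Fin 0 → V) (v : Fin 1 → V),
    M 0 1 (PiTensorProduct.tprod K w ⊗ₜ PiTensorProduct.tprod K v) = v 0
  left_zero : ∀ n : ℕ, 2 ≤ n → M n 0 = 0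
  right_zero : ∀ n : ℕ, 2 ≤ n → M 0 n = 0
  /-- `β_{1k} (M_{ij} ⊗ id^{⊗ k}) = (id^{⊗ k} ⊗ M_{ij}) β_{i+j,k}` -/
  braid_left : ∀ i j k : ℕ, 1 ≤ i → 1 ≤ j → 1 ≤ k →
    betaComp σ 1 k ∘ₗ ((powOne K V).symm.toLinearMap ∘ₗ M i j).rTensor (⨂[K]^k V) =
      ((powOne K V).symm.toLinearMap ∘ₗ M i j).lTensor (⨂[K]^k V) ∘ₗ
        (split K V (n := i + j) rfl).toLinearMap.lTensor (⨂[K]^k V) ∘ₗ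
        betaComp σ (i + j) k ∘ₗ
        (split K V (n := i + j) rfl).symm.toLinearMap.rTensor (⨂[K]^k V)
  /-- `β_{i1} (id^{⊗ i} ⊗ M_{jk}) = (M_{jk} ⊗ id^{⊗ i}) β_{i,j+k}` -/
  braid_right : ∀ i j k : ℕ, 1 ≤ i → 1 ≤ j → 1 ≤ k →
    betaComp σ i 1 ∘ₗ ((powOne K V).symm.toLinearMap ∘ₗ M j k).lTensor (⨂[K]^i V) =
      ((powOne K V).symm.toLinearMap ∘ₗ M j k).rTensor (⨂[K]^i V) ∘ₗ
        (split K V (n := j + k) rfl).toLinearMap.rTensor (⨂[K]^i V) ∘ₗ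
        betaComp σ i (j + k) ∘ₗ
        (split K V (n := j + k) rfl).symm.toLinearMap.lTensor (⨂[K]^i V)
  /-- `∑_{r=1}^{i+j} M_{rk} ∘ ((M^{⊗ r} ∘ △_β^{(r-1)}) ⊗ id^{⊗ k})
  = ∑_{l=1}^{j+k} M_{il} ∘ (id^{⊗ i} ⊗ (M^{⊗ l} ∘ △_β^{(l-1)}))`, with `r - 1` and `l - 1` as
  summation indices -/
  assoc : ∀ i j k : ℕ, 1 ≤ i → 1 ≤ j → 1 ≤ k →
    ∑ r ∈ Finset.range (i + j),
        M (r + 1) k ∘ₗ (opPow σ M r ∘ₗ incl₂ K V i j).rTensor (⨂[K]^k V) =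
      (∑ l ∈ Finset.range (j + k),
        M i (l + 1) ∘ₗ (opPow σ M l ∘ₗ incl₂ K V j k).lTensor (⨂[K]^i V)) ∘ₗ
        (TensorProduct.assoc K (⨂[K]^i V) (⨂[K]^j V) (⨂[K]^k V)).toLinearMap

end TensorSpace

/-! ### Diagonal structures on `V^{⊗ n}` and `T(V)` -/

section Diagonal

variable {K H V : Type*} [Field K] [Ring H] [HopfAlgebra K H] [AddCommMonoid V] [Module K V]

/-- The diagonal structure on `V^{⊗ n}`, through `V^{⊗ 0} = K` and `V^{⊗ (n+1)} = V ⊗ V^{⊗ n}`. -/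
def ActCoact.pow (D : ActCoact K H V) : (n : ℕ) → ActCoact K H (⨂[K]^n V)
  | 0 => ActCoact.unit.transport (PiTensorProduct.isEmptyEquiv (Fin 0)).symm
  | n + 1 => (D.tensor (D.pow n)).transport
      ((split K V (n := n + 1) (i := 1) (j := n) (add_comm 1 n)).trans
        (TensorProduct.congr (powOne K V) (LinearEquiv.refl K _))).symm

/-- The diagonal structure on `T(V)`. -/
def ActCoact.tensorSpace (D : ActCoact K H V) : ActCoact K H (TensorSpace K V) :=
  ActCoact.directSum D.pow

end Diagonal

/-! ### Checks: `chiWord` is reduced, and `star` is the full (locally finite) sum -/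

section Checks

theorem wordPerm_range_map (i j k : ℕ) :
    wordPerm ((List.range i).map (fun a => j + a)) k =
      if j ≤ k ∧ k < j + i then k + 1 else if k = j + i then j else k := by
  induction i generalizing k with
  | zero =>
    simp only [wordPerm, List.range_zero, List.map_nil, List.prod_nil, Equiv.Perm.coe_one, id]
    split_ifs <;> omega
  | succ i ih =>
    have h : wordPerm ((List.range (i + 1)).map (fun a => j + a)) =
        wordPerm ((List.range i).map (fun a => j + a)) * Equiv.swap (j + i) (j + i + 1) := by
      simp [wordPerm, List.range_succ]
    rw [h, Equiv.Perm.mul_apply, ih]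
    simp only [Equiv.swap_apply_def]
    split_ifs <;> omega

/-- The word `chiWord i j` represents `χ_{ij}`. -/
theorem wordPerm_chiWord (i j k : ℕ) :
    wordPerm (chiWord i j) k = if k < i then j + k else if k < i + j then k - i else k := by
  induction j generalizing k with
  | zero =>
    simp only [wordPerm, chiWord, List.map_nil, List.prod_nil, Equiv.Perm.coe_one, id]
    split_ifs <;> omega
  | succ j ih =>
    have h : wordPerm (chiWord i (j + 1)) =
        wordPerm ((List.range i).map (fun a => j + a)) * wordPerm (chiWord i j) := by
      simp only [wordPerm, chiWord, List.map_append, List.prod_append]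
    rw [h, Equiv.Perm.mul_apply, ih, wordPerm_range_map]
    split_ifs <;> omega

theorem length_chiWord (i j : ℕ) : (chiWord i j).length = i * j := by
  induction j with
  | zero => simp [chiWord]
  | succ j ih => simp [chiWord, ih, Nat.mul_succ, add_comm]

theorem card_inversions_le (N : ℕ) (w : List ℕ) :
    ((Finset.range N ×ˢ Finset.range N).filter
      fun x => x.1 < x.2 ∧ wordPerm w x.2 < wordPerm w x.1).card ≤ w.length := by
  induction w with
  | nil =>
    simp only [wordPerm, List.map_nil, List.prod_nil, Equiv.Perm.coe_one, id, List.length_nil,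
      nonpos_iff_eq_zero, Finset.card_eq_zero, Finset.filter_eq_empty_iff]
    omega
  | cons a w ih =>
    have hw : wordPerm (a :: w) = Equiv.swap a (a + 1) * wordPerm w := by simp [wordPerm]
    rw [List.length_cons]
    refine le_trans (Finset.card_le_card ?_) (le_trans (Finset.card_insert_le
      ((wordPerm w).symm a, (wordPerm w).symm (a + 1)) _) (Nat.succ_le_succ ih))
    rintro ⟨x, y⟩ hxy
    simp only [Finset.mem_filter, Finset.mem_insert, hw, Equiv.Perm.mul_apply, Prod.mk.injEq,
      Equiv.eq_symm_apply] at hxy ⊢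
    obtain ⟨h1, h2, h3⟩ := hxy
    have hne : wordPerm w x ≠ wordPerm w y := fun h => h2.ne ((wordPerm w).injective h)
    by_cases hlt : wordPerm w y < wordPerm w x
    · exact Or.inr ⟨h1, h2, hlt⟩
    · left
      simp only [Equiv.swap_apply_def] at h3
      split_ifs at h3 <;> omega

/-- `chiWord i j` is a reduced word. -/
theorem chiWord_reduced (i j : ℕ) (w : List ℕ) (hw : wordPerm w = wordPerm (chiWord i j)) :
    (chiWord i j).length ≤ w.length := by
  refine le_trans ?_ (card_inversions_le (i + j) w)
  rw [length_chiWord, hw]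
  calc i * j = ((Finset.range i ×ˢ Finset.range j).image fun x => (x.1, i + x.2)).card := by
        rw [Finset.card_image_of_injective _ (fun x y h => by
          simp only [Prod.mk.injEq] at h; exact Prod.ext h.1 (by omega))]
        simp
    _ ≤ _ := Finset.card_le_card (by
        rintro ⟨x, y⟩ hxy
        simp only [Finset.mem_image, Finset.mem_product, Finset.mem_range, Prod.mk.injEq,
          Prod.exists] at hxy
        obtain ⟨a, b, ⟨ha, hb⟩, rfl, rfl⟩ := hxy
        simp only [Finset.mem_filter, Finset.mem_product, Finset.mem_range, wordPerm_chiWord]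
        refine ⟨⟨by omega, by omega⟩, by omega, ?_⟩
        split_ifs <;> omega)

variable {K V : Type*} [Field K] [AddCommMonoid V] [Module K V]

theorem beta_incl (σ : V ⊗[K] V →ₗ[K] V ⊗[K] V) (i j : ℕ) (x : ⨂[K]^i V) (y : ⨂[K]^j V) :
    beta σ (incl K V i x ⊗ₜ incl K V j y) = incl₂ K V j i (betaComp σ i j (x ⊗ₜ y)) :=
  LinearMap.congr_fun (ofComponents_incl₂ (fun i j => incl₂ K V j i ∘ₗ betaComp σ i j) i j)
    (x ⊗ₜ y)

theorem comulBeta_incl_mem (σ : V ⊗[K] V →ₗ[K] V ⊗[K] V) (i j : ℕ) (x : ⨂[K]^i V)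
    (y : ⨂[K]^j V)
    (S : Submodule K
      ((TensorSpace K V ⊗[K] TensorSpace K V) ⊗[K] (TensorSpace K V ⊗[K] TensorSpace K V)))
    (hS : ∀ a b c d : ℕ, a + b + (c + d) = i + j → ∀ (s : ⨂[K]^a V) (t : ⨂[K]^b V)
      (u : ⨂[K]^c V) (v : ⨂[K]^d V),
      (incl K V a s ⊗ₜ incl K V b t) ⊗ₜ (incl K V c u ⊗ₜ incl K V d v) ∈ S) :
    comulBeta σ (incl K V i x ⊗ₜ incl K V j y) ∈ S := by
  simp only [comulBeta, LinearMap.comp_apply, TensorProduct.map_tmul, deconcat,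
    DirectSum.toModule_lof, LinearMap.sum_apply, TensorProduct.sum_tmul, TensorProduct.tmul_sum,
    map_sum, LinearEquiv.coe_coe]
  refine Submodule.sum_mem _ fun p _ => Submodule.sum_mem _ fun q _ => ?_
  have hp := p.2
  have hq := q.2
  generalize split K V _ x = X
  generalize split K V _ y = Y
  induction X using TensorProduct.induction_on with
  | zero => simp
  | add X X' h h' =>
    simp only [map_add, TensorProduct.add_tmul]
    exact S.add_mem h h'
  | tmul s t =>
  induction Y using TensorProduct.induction_on with
  | zero => simp
  | add X X' h h' =>
    simp only [map_add, TensorProduct.tmul_add]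
    exact S.add_mem h h'
  | tmul u v =>
  simp only [regroup, TensorProduct.map_tmul, LinearEquiv.trans_apply, TensorProduct.assoc_tmul,
    TensorProduct.congr_tmul, LinearEquiv.refl_apply, TensorProduct.assoc_symm_tmul,
    LinearMap.lTensor_tmul, LinearMap.rTensor_tmul, beta_incl]
  generalize betaComp σ _ _ _ = Z
  induction Z using TensorProduct.induction_on with
  | zero => simp
  | add X X' h h' =>
    simp only [map_add, TensorProduct.tmul_add, TensorProduct.add_tmul]
    exact S.add_mem h h'
  | tmul u t =>
  simp only [TensorProduct.map_tmul, LinearEquiv.trans_symm, LinearEquiv.trans_apply,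
    TensorProduct.congr_symm_tmul, LinearEquiv.refl_symm, LinearEquiv.refl_apply,
    LinearEquiv.symm_symm, TensorProduct.assoc_tmul, TensorProduct.assoc_symm_tmul]
  exact hS _ _ _ _ (by omega) _ _ _ _

theorem map_split_symm {C : Type*} [AddCommMonoid C] [Module K C] (f : C →ₗ[K] V) {n i j : ℕ}
    (h : i + j = n) (X : ⨂[K]^i C) (Y : ⨂[K]^j C) :
    PiTensorProduct.map (fun _ : Fin n => f) ((split K C h).symm (X ⊗ₜ Y)) =
      (split K V h).symm (PiTensorProduct.map (fun _ => f) X ⊗ₜ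
        PiTensorProduct.map (fun _ => f) Y) := by
  induction X using PiTensorProduct.induction_on with
  | add X X' h h' => simp only [map_add, TensorProduct.add_tmul, h, h']
  | smul_tprod r v =>
  induction Y using PiTensorProduct.induction_on with
  | add X X' h h' => simp only [map_add, TensorProduct.tmul_add, h, h']
  | smul_tprod s w =>
  simp only [map_smul, ← TensorProduct.smul_tmul', TensorProduct.tmul_smul, split_symm_tprod,
    PiTensorProduct.map_tprod]
  congr 3
  subst h
  ext a
  refine Fin.addCases (fun a => ?_) (fun a => ?_) a <;> simp [Function.comp]

theorem opPow_incl_eq_zero (σ : V ⊗[K] V →ₗ[K] V ⊗[K] V) (M : Operations K V) (hM : M 0 0 = 0)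
    (n i j : ℕ) (hn : i + j < n + 1) (x : ⨂[K]^i V) (y : ⨂[K]^j V) :
    opPow σ M n (incl K V i x ⊗ₜ incl K V j y) = 0 := by
  have hM' : ∀ (i j : ℕ) (x : ⨂[K]^i V) (y : ⨂[K]^j V), i + j = 0 →
      ofComponents M (incl K V i x ⊗ₜ incl K V j y) = 0 := by
    intro i j x y h
    obtain rfl : i = 0 := by omega
    obtain rfl : j = 0 := by omega
    have := LinearMap.congr_fun (ofComponents_incl₂ M 0 0) (x ⊗ₜ y)
    rw [hM] at this
    exact this
  have hp : ∀ c : TensorSpace K V ⊗[K] TensorSpace K V, ofComponents M c = 0 →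
      PiTensorProduct.map (fun _ : Fin 1 => ofComponents M) ((powOne K _).symm c) = 0 := by
    intro c hc
    rw [powOne, PiTensorProduct.subsingletonEquiv_symm_apply, PiTensorProduct.map_tprod]
    exact (PiTensorProduct.tprod K).map_coord_zero 0 hc
  induction n generalizing i j with
  | zero => exact hp _ (hM' i j x y (by omega))
  | succ n ih =>
    have := comulBeta_incl_mem σ i j x y (LinearMap.ker
      (PiTensorProduct.map (fun _ : Fin (n + 1 + 1) => ofComponents M) ∘ₗ
        (split K _ (n := n + 1 + 1) (i := n + 1) (j := 1) rfl).symm.toLinearMap ∘ₗ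
        TensorProduct.map (iterComul (comulBeta σ) n) (powOne K _).symm.toLinearMap)) ?_
    · exact this
    · intro a b c d h s t u v
      rw [LinearMap.mem_ker]
      simp only [LinearMap.comp_apply, TensorProduct.map_tmul, LinearEquiv.coe_coe]
      rw [map_split_symm]
      by_cases hcd : c + d = 0
      · rw [hp _ (hM' c d u v hcd), TensorProduct.tmul_zero, map_zero]
      · have h0 := ih a b (by omega) s t
        rw [opPow, LinearMap.comp_apply] at h0
        rw [h0, TensorProduct.zero_tmul, map_zero]

/-- If `M_{00} = 0` then `∗` is `ε ⊗ ε + ∑_{n ≥ 1} M^{⊗ n} ∘ △_β^{(n-1)}`: on each element all but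
finitely many summands are zero, and the sum is the value of `∗`. -/
theorem star_eq_sum (σ : V ⊗[K] V →ₗ[K] V ⊗[K] V) (M : Operations K V) (hM : M 0 0 = 0)
    (x : TensorSpace K V ⊗[K] TensorSpace K V) :
    ∃ N₀ : ℕ, (∀ n, N₀ ≤ n → opPow σ M n x = 0) ∧
      star σ M x = counitTensor K V x +
        ∑ n ∈ Finset.range N₀, incl K V (n + 1) (opPow σ M n x) := by
  suffices h : ∃ N₀ : ℕ, (∀ n, N₀ ≤ n → opPow σ M n x = 0) ∧ ∀ N, N₀ ≤ N →
      star σ M x = counitTensor K V x +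
        ∑ n ∈ Finset.range N, incl K V (n + 1) (opPow σ M n x) by
    obtain ⟨N, h1, h2⟩ := h
    exact ⟨N, h1, h2 N le_rfl⟩
  have hadd : ∀ x y : TensorSpace K V ⊗[K] TensorSpace K V,
      (∃ N₀ : ℕ, (∀ n, N₀ ≤ n → opPow σ M n x = 0) ∧ ∀ N, N₀ ≤ N →
        star σ M x = counitTensor K V x +
          ∑ n ∈ Finset.range N, incl K V (n + 1) (opPow σ M n x)) →
      (∃ N₀ : ℕ, (∀ n, N₀ ≤ n → opPow σ M n y = 0) ∧ ∀ N, N₀ ≤ N →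
        star σ M y = counitTensor K V y +
          ∑ n ∈ Finset.range N, incl K V (n + 1) (opPow σ M n y)) →
      (∃ N₀ : ℕ, (∀ n, N₀ ≤ n → opPow σ M n (x + y) = 0) ∧ ∀ N, N₀ ≤ N →
        star σ M (x + y) = counitTensor K V (x + y) +
          ∑ n ∈ Finset.range N, incl K V (n + 1) (opPow σ M n (x + y))) := by
    rintro x y ⟨N, h1, h2⟩ ⟨N', h1', h2'⟩
    refine ⟨max N N', fun n hn => ?_, fun n hn => ?_⟩
    · rw [map_add, h1 n (le_trans (le_max_left _ _) hn), h1' n (le_trans (le_max_right _ _) hn),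
        add_zero]
    · simp only [map_add, Finset.sum_add_distrib]
      rw [h2 n (le_trans (le_max_left _ _) hn), h2' n (le_trans (le_max_right _ _) hn),
        add_add_add_comm]
  induction x using TensorProduct.induction_on with
  | zero => exact ⟨0, by simp⟩
  | add x y hx hy => exact hadd x y hx hy
  | tmul x y =>
  induction x using DirectSum.induction_on with
  | zero => exact ⟨0, by simp⟩
  | add x x' hx hx' => rw [TensorProduct.add_tmul]; exact hadd _ _ hx hx'
  | of i x =>
  induction y using DirectSum.induction_on with
  | zero => exact ⟨0, by simp⟩
  | add x x' hx hx' => rw [TensorProduct.tmul_add]; exact hadd _ _ hx hx'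
  | of j y =>
  change ∃ N₀ : ℕ, (∀ n, N₀ ≤ n → opPow σ M n (incl K V i x ⊗ₜ incl K V j y) = 0) ∧
    ∀ N, N₀ ≤ N → star σ M (incl K V i x ⊗ₜ incl K V j y) =
      counitTensor K V (incl K V i x ⊗ₜ incl K V j y) +
        ∑ n ∈ Finset.range N, incl K V (n + 1) (opPow σ M n (incl K V i x ⊗ₜ incl K V j y))
  have h0 : ∀ n, i + j ≤ n → opPow σ M n (incl K V i x ⊗ₜ incl K V j y) = 0 :=
    fun n hn => opPow_incl_eq_zero σ M hM n i j (by omega) x y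
  refine ⟨i + j, h0, fun N hN => ?_⟩
  rw [← Finset.sum_subset (Finset.range_subset_range.2 hN)
    (fun n _ hn => by rw [h0 n (by simpa using hn), map_zero])]
  have h := LinearMap.congr_fun (ofComponents_incl₂ (fun i j =>
    (counitTensor K V + ∑ n ∈ Finset.range (i + j), incl K V (n + 1) ∘ₗ opPow σ M n) ∘ₗ
      incl₂ K V i j) i j) (x ⊗ₜ y)
  rw [LinearMap.comp_apply, TensorProduct.map_tmul] at h
  rw [star, h]
  simp only [LinearMap.comp_apply, TensorProduct.map_tmul, LinearMap.add_apply,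
    LinearMap.sum_apply]

end Checks

end QMB

end

namespace QMB

open TensorProduct

section YD

variable {K H : Type*} [Field K] [Ring H] [HopfAlgebra K H]
variable {X Y Z X' Y' : Type*} [AddCommMonoid X] [Module K X] [AddCommMonoid Y] [Module K Y]
  [AddCommMonoid Z] [Module K Z] [AddCommMonoid X'] [Module K X'] [AddCommMonoid Y'] [Module K Y']

/-! The tensor space `T(V)` with deconcatenation behaves like a cofree coalgebra: a map `f : C →
T(V)` compatible with coproducts is determined by its components in degrees `0` and `1`, because its
degree `n + 1` part is the concatenation of its degree `n` and degree `1` parts along the coproduct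
of `C` (`coalgebraMap_ext`). Every identity between maps built from `∗` is checked through this
principle.

For it to apply, `∗` must be a coalgebra map. Since `σ` is the natural braiding, the hexagon
identities and induction along the reduced word show that the operator `β` is the categorical
braiding of `T(V)` with itself (`betaComp_eq_braid`, `beta_eq_braid`). Hence `△_β` is the coproduct
of a braided tensor product of coalgebras, and it is coassociative and counital
(`tensorComul_coassoc`, `counitMul_comulBeta_left`, `counitMul_comulBeta_right`). Coassociativity
allows `M^{⊗ n} ∘ △_β^{(n-1)}` to be cut at any place (`split_opPow`), which says exactly that `∗`
is a coalgebra map with degree `0` part `ε ⊗ ε` and degree `1` part `M` (`deconcat_star`).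

All operations are morphisms of Yetter-Drinfeld modules, so `∗` is one too (`isMorphism_star`) and
slides through the braiding by naturality. Both bracketings of a triple product are therefore
coalgebra maps on the threefold braided tensor product. In degree `0` both are the product of three
counits. In degree `1`, on tensors of positive length, they agree by condition (iii). If one of the
lengths is zero, they agree because the unit of `T(V)` is a unit for `∗`, which is itself an
application of the uniqueness principle (`unitMap_star`, `star_unitMap`). The object `T(V)` is
Yetter-Drinfeld because the axioms pass to tensor products and direct sums
(`IsYetterDrinfeld.tensor`, `IsYetterDrinfeld.of_span`). -/

theorem ActCoact.tensor_act_tmul (D : ActCoact K H X) (E : ActCoact K H Y) (h : H) (u : X ⊗[K] Y) :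
    (D.tensor E).act (h ⊗ₜ u) =
      map D.act E.act (tensorTensorTensorComm K H H X Y (Coalgebra.comul (R := K) h ⊗ₜ u)) := rfl

theorem ActCoact.tensor_coact_tmul (D : ActCoact K H X) (E : ActCoact K H Y) (x : X) (y : Y) :
    (D.tensor E).coact (x ⊗ₜ y) = (LinearMap.mul' K H).rTensor (X ⊗[K] Y)
      (tensorTensorTensorComm K H X H Y (D.coact x ⊗ₜ E.coact y)) := rfl

/-! ### Morphisms -/

section Morphisms

variable {D : ActCoact K H X} {E : ActCoact K H Y} {F : ActCoact K H Z}

theorem IsMorphism.apply_act {f : X →ₗ[K] Y} (hf : IsMorphism D E f) (u : H ⊗[K] X) :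
    f (D.act u) = E.act (f.lTensor H u) := LinearMap.congr_fun hf.map_act u

theorem IsMorphism.coact_apply {f : X →ₗ[K] Y} (hf : IsMorphism D E f) (x : X) :
    E.coact (f x) = f.lTensor H (D.coact x) := LinearMap.congr_fun hf.map_coact x

theorem IsMorphism.of_apply {f : X →ₗ[K] Y} (h₁ : ∀ h x, f (D.act (h ⊗ₜ x)) = E.act (h ⊗ₜ f x))
    (h₂ : ∀ x, E.coact (f x) = f.lTensor H (D.coact x)) : IsMorphism D E f :=
  ⟨TensorProduct.ext' h₁, LinearMap.ext h₂⟩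

theorem IsMorphism.id : IsMorphism D D LinearMap.id :=
  .of_apply (fun _ _ => rfl) fun x => by simp

theorem IsMorphism.comp {g : Y →ₗ[K] Z} {f : X →ₗ[K] Y} (hg : IsMorphism E F g)
    (hf : IsMorphism D E f) : IsMorphism D F (g ∘ₗ f) :=
  .of_apply (fun h x => by simp [hf.apply_act, hg.apply_act])
    fun x => by simp [hf.coact_apply, hg.coact_apply, LinearMap.lTensor_comp_apply]

theorem IsMorphism.zero : IsMorphism D E 0 :=
  .of_apply (fun h x => by simp) fun x => by simp

theorem IsMorphism.add {f g : X →ₗ[K] Y} (hf : IsMorphism D E f) (hg : IsMorphism D E g) :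
    IsMorphism D E (f + g) :=
  .of_apply (fun h x => by simp [hf.apply_act, hg.apply_act, tmul_add])
    fun x => by simp [hf.coact_apply, hg.coact_apply, LinearMap.lTensor_add]

theorem IsMorphism.sum {ι : Type*} (s : Finset ι) {f : ι → X →ₗ[K] Y}
    (hf : ∀ i ∈ s, IsMorphism D E (f i)) : IsMorphism D E (∑ i ∈ s, f i) := by
  classical
  induction s using Finset.induction_on with
  | empty => exact .zero
  | insert a s ha ih =>
    rw [Finset.sum_insert ha]
    exact (hf a (by simp)).add (ih fun i hi => hf i (by simp [hi]))

theorem IsMorphism.symm {e : X ≃ₗ[K] Y} (he : IsMorphism D E e.toLinearMap) :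
    IsMorphism E D e.symm.toLinearMap := by
  refine .of_apply (fun h y => ?_) fun y => ?_
  · have := he.apply_act (h ⊗ₜ e.symm y)
    simp only [LinearEquiv.coe_coe, LinearMap.lTensor_tmul, LinearEquiv.apply_symm_apply] at this
    rw [LinearEquiv.coe_coe, ← this, LinearEquiv.symm_apply_apply]
  · have := he.coact_apply (e.symm y)
    simp only [LinearEquiv.coe_coe, LinearEquiv.apply_symm_apply] at this
    rw [this, ← LinearMap.lTensor_comp_apply]
    simp

theorem isMorphism_transport (D : ActCoact K H X) (e : X ≃ₗ[K] Y) :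
    IsMorphism D (D.transport e) e.toLinearMap :=
  .of_apply (fun h x => by simp [ActCoact.transport]) fun x => by simp [ActCoact.transport]

theorem IsMorphism.tensor {D' : ActCoact K H X'} {E' : ActCoact K H Y'} {f : X →ₗ[K] X'}
    {g : Y →ₗ[K] Y'} (hf : IsMorphism D D' f) (hg : IsMorphism E E' g) :
    IsMorphism (D.tensor E) (D'.tensor E') (map f g) := by
  refine .of_apply (fun h u => ?_) fun u => ?_
  · induction u using TensorProduct.induction_on with
    | zero => simp
    | add u v hu hv => simp only [map_add, tmul_add, hu, hv]
    | tmul x y =>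
      simp only [ActCoact.tensor_act_tmul, map_tmul]
      -- Sweedler computations take this form throughout: both sides are linear in the coproduct or
      -- coaction, so it is replaced by an arbitrary tensor and then by a pure one.
      generalize Coalgebra.comul (R := K) h = c
      induction c using TensorProduct.induction_on with
      | zero => simp
      | add u v hu hv => simp only [map_add, add_tmul, hu, hv]
      | tmul a b => simp [hf.apply_act, hg.apply_act]
  · induction u using TensorProduct.induction_on with
    | zero => simp
    | add u v hu hv => simp only [map_add, hu, hv]
    | tmul x y =>
      simp only [ActCoact.tensor_coact_tmul, map_tmul, hf.coact_apply, hg.coact_apply]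
      generalize D.coact x = u
      generalize E.coact y = v
      induction u using TensorProduct.induction_on with
      | zero => simp
      | add u v hu hv => simp only [map_add, add_tmul, hu, hv]
      | tmul a b =>
      induction v using TensorProduct.induction_on with
      | zero => simp
      | add u v hu hv => simp only [map_add, tmul_add, hu, hv]
      | tmul a b => simp

/-- Linearity is coassociativity of `H`; colinearity is associativity of its multiplication. -/
theorem isMorphism_assoc (D : ActCoact K H X) (E : ActCoact K H Y) (F : ActCoact K H Z) :
    IsMorphism ((D.tensor E).tensor F) (D.tensor (E.tensor F))
      (TensorProduct.assoc K X Y Z).toLinearMap := by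
  refine .of_apply (fun h u => ?_) fun u => ?_
  · induction u using TensorProduct.induction_on with
    | zero => simp
    | add u v hu hv => simp only [map_add, tmul_add, hu, hv]
    | tmul u z =>
    induction u using TensorProduct.induction_on with
    | zero => simp
    | add u v hu hv => simp only [map_add, tmul_add, add_tmul, hu, hv]
    | tmul x y =>
    -- Acting on the left bracketing takes the coproduct of the first leg; the rewrite with
    -- `Coalgebra.coassoc_apply` below moves it to the second leg, as the right bracketing requires.
    have key : ∀ c : H ⊗[K] H, (TensorProduct.assoc K X Y Z) (map (D.tensor E).act F.act
        (tensorTensorTensorComm K H H (X ⊗[K] Y) Z (c ⊗ₜ ((x ⊗ₜ y) ⊗ₜ z)))) =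
        map D.act (map E.act F.act) (map LinearMap.id (tensorTensorTensorComm K H H Y Z).toLinearMap
          (tensorTensorTensorComm K H (H ⊗[K] H) X (Y ⊗[K] Z)
          (TensorProduct.assoc K H H H ((Coalgebra.comul (R := K)).rTensor H c) ⊗ₜ
            (x ⊗ₜ (y ⊗ₜ z))))) := by
      intro c
      induction c using TensorProduct.induction_on with
      | zero => simp
      | add u v hu hv => simp only [map_add, add_tmul, hu, hv]
      | tmul a b =>
      simp only [tensorTensorTensorComm_tmul, map_tmul, ActCoact.tensor_act_tmul,
        LinearMap.rTensor_tmul]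
      generalize Coalgebra.comul (R := K) a = c
      induction c using TensorProduct.induction_on with
      | zero => simp
      | add u v hu hv => simp only [map_add, add_tmul, hu, hv]
      | tmul a b => simp
    rw [LinearEquiv.coe_coe, ActCoact.tensor_act_tmul, key, Coalgebra.coassoc_apply,
      assoc_tmul, ActCoact.tensor_act_tmul]
    generalize Coalgebra.comul (R := K) h = c
    induction c using TensorProduct.induction_on with
    | zero => simp
    | add u v hu hv => simp only [map_add, add_tmul, hu, hv]
    | tmul a b => simp [ActCoact.tensor_act_tmul]
  · induction u using TensorProduct.induction_on with
    | zero => simp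
    | add u v hu hv => simp only [map_add, hu, hv]
    | tmul u z =>
    induction u using TensorProduct.induction_on with
    | zero => simp
    | add u v hu hv => simp only [map_add, add_tmul, hu, hv]
    | tmul x y =>
    simp only [LinearEquiv.coe_coe, assoc_tmul, ActCoact.tensor_coact_tmul]
    generalize D.coact x = u
    generalize E.coact y = v
    generalize F.coact z = w
    induction u using TensorProduct.induction_on with
    | zero => simp
    | add u v hu hv => simp only [map_add, add_tmul, hu, hv]
    | tmul a x =>
    induction v using TensorProduct.induction_on with
    | zero => simp
    | add u v hu hv => simp only [map_add, add_tmul, tmul_add, hu, hv]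
    | tmul b y =>
    induction w using TensorProduct.induction_on with
    | zero => simp
    | add u v hu hv => simp only [map_add, tmul_add, hu, hv]
    | tmul c z => simp [mul_assoc]

/-- The action part is the counit law of `H`, and the coaction part is its unit law. -/
theorem isMorphism_lid (D : ActCoact K H X) :
    IsMorphism (ActCoact.unit.tensor D) D (TensorProduct.lid K X).toLinearMap := by
  refine .of_apply (fun h u => ?_) fun u => ?_
  · induction u using TensorProduct.induction_on with
    | zero => simp
    | add u v hu hv => simp only [map_add, tmul_add, hu, hv]
    | tmul r x =>
    have key : ∀ c : H ⊗[K] H, (TensorProduct.lid K X) (map ActCoact.unit.act D.act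
        (tensorTensorTensorComm K H H K X (c ⊗ₜ (r ⊗ₜ x)))) =
        r • D.act (TensorProduct.lid K H ((Coalgebra.counit (R := K)).rTensor H c) ⊗ₜ x) := by
      intro c
      induction c using TensorProduct.induction_on with
      | zero => simp
      | add u v hu hv => simp only [map_add, add_tmul, hu, hv, smul_add]
      | tmul a b => simp [ActCoact.unit, smul_smul, ← smul_tmul', mul_comm]
    rw [LinearEquiv.coe_coe, ActCoact.tensor_act_tmul, key, Coalgebra.rTensor_counit_comul]
    simp
  · induction u using TensorProduct.induction_on with
    | zero => simp
    | add u v hu hv => simp only [map_add, hu, hv]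
    | tmul r x =>
    simp only [LinearEquiv.coe_coe, lid_tmul, ActCoact.tensor_coact_tmul, map_smul]
    generalize D.coact x = u
    induction u using TensorProduct.induction_on with
    | zero => simp
    | add u v hu hv => simp only [map_add, tmul_add, smul_add, hu, hv]
    | tmul a x => simp [ActCoact.unit]

theorem isMorphism_rid (D : ActCoact K H X) :
    IsMorphism (D.tensor ActCoact.unit) D (TensorProduct.rid K X).toLinearMap := by
  refine .of_apply (fun h u => ?_) fun u => ?_
  · induction u using TensorProduct.induction_on with
    | zero => simp
    | add u v hu hv => simp only [map_add, tmul_add, hu, hv]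
    | tmul x r =>
    have key : ∀ c : H ⊗[K] H, (TensorProduct.rid K X) (map D.act ActCoact.unit.act
        (tensorTensorTensorComm K H H X K (c ⊗ₜ (x ⊗ₜ r)))) =
        r • D.act (TensorProduct.rid K H ((Coalgebra.counit (R := K)).lTensor H c) ⊗ₜ x) := by
      intro c
      induction c using TensorProduct.induction_on with
      | zero => simp
      | add u v hu hv => simp only [map_add, add_tmul, hu, hv, smul_add]
      | tmul a b => simp [ActCoact.unit, smul_smul, ← smul_tmul', mul_comm]
    rw [LinearEquiv.coe_coe, ActCoact.tensor_act_tmul, key, Coalgebra.lTensor_counit_comul]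
    simp
  · induction u using TensorProduct.induction_on with
    | zero => simp
    | add u v hu hv => simp only [map_add, hu, hv]
    | tmul x r =>
    simp only [LinearEquiv.coe_coe, rid_tmul, ActCoact.tensor_coact_tmul, map_smul]
    generalize D.coact x = u
    induction u using TensorProduct.induction_on with
    | zero => simp
    | add u v hu hv => simp only [map_add, add_tmul, smul_add, hu, hv]
    | tmul a x => simp [ActCoact.unit]

end Morphisms

end YD

section YD

variable {K H : Type*} [Field K] [Ring H] [HopfAlgebra K H]
variable {X Y Z X' Y' : Type*} [AddCommMonoid X] [Module K X] [AddCommMonoid Y] [Module K Y]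
  [AddCommMonoid Z] [Module K Z] [AddCommMonoid X'] [Module K X'] [AddCommMonoid Y'] [Module K Y']

/-! ### Constructions of Yetter-Drinfeld modules -/

section YetterDrinfeld

variable {D : ActCoact K H X} {E : ActCoact K H Y} {F : ActCoact K H Z}

theorem IsYetterDrinfeld.counit_coact_apply (hD : IsYetterDrinfeld D) (x : X) :
    TensorProduct.lid K X ((Coalgebra.counit (R := K) (A := H)).rTensor X (D.coact x)) = x :=
  LinearMap.congr_fun hD.counit_coact x

theorem IsYetterDrinfeld.coassoc_apply (hD : IsYetterDrinfeld D) (x : X) :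
    D.coact.lTensor H (D.coact x) = TensorProduct.assoc K H H X
      ((Coalgebra.comul (R := K) (A := H)).rTensor X (D.coact x)) :=
  LinearMap.congr_fun hD.coassoc x

/-- The map `(g ⊗ h) ⊗ (a ⊗ x) ↦ g a ⊗ h · x`. -/
noncomputable def mulAct (D : ActCoact K H X) : (H ⊗[K] H) ⊗[K] (H ⊗[K] X) →ₗ[K] H ⊗[K] X :=
  map (LinearMap.mul' K H) D.act ∘ₗ (tensorTensorTensorComm K H H H X).toLinearMap

/-- Right multiplication on the first factor of `H ⊗ X`. -/
noncomputable def mulRight (H X : Type*) [Ring H] [HopfAlgebra K H] [AddCommMonoid X] [Module K X] :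
    (H ⊗[K] X) ⊗[K] H →ₗ[K] H ⊗[K] X :=
  (LinearMap.mul' K H).rTensor X ∘ₗ (rightComm K H X H).toLinearMap

/-- The map `(g ⊗ h) ⊗ x ↦ (g · x)₍₋₁₎ h ⊗ (g · x)₍₀₎`. -/
noncomputable def coactActMul (D : ActCoact K H X) : (H ⊗[K] H) ⊗[K] X →ₗ[K] H ⊗[K] X :=
  mulRight H X ∘ₗ (D.coact ∘ₗ D.act).rTensor H ∘ₗ (rightComm K H H X).toLinearMap

/-- Multiplication of the first factors. -/
noncomputable def mulTensor (H X Y : Type*) [Ring H] [HopfAlgebra K H] [AddCommMonoid X] [Module K X]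
    [AddCommMonoid Y] [Module K Y] : (H ⊗[K] X) ⊗[K] (H ⊗[K] Y) →ₗ[K] H ⊗[K] (X ⊗[K] Y) :=
  (LinearMap.mul' K H).rTensor (X ⊗[K] Y) ∘ₗ (tensorTensorTensorComm K H X H Y).toLinearMap

@[simp]
theorem mulAct_tmul (g h a : H) (x : X) :
    mulAct D ((g ⊗ₜ h) ⊗ₜ (a ⊗ₜ x)) = (g * a) ⊗ₜ D.act (h ⊗ₜ x) := rfl

@[simp]
theorem mulRight_tmul (a h : H) (x : X) :
    mulRight (K := K) H X ((a ⊗ₜ x) ⊗ₜ h) = (a * h) ⊗ₜ x := rfl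

@[simp]
theorem coactActMul_tmul (g h : H) (x : X) :
    coactActMul D ((g ⊗ₜ h) ⊗ₜ x) = mulRight H X (D.coact (D.act (g ⊗ₜ x)) ⊗ₜ h) := rfl

@[simp]
theorem mulTensor_tmul (a b : H) (x : X) (y : Y) :
    mulTensor (K := K) H X Y ((a ⊗ₜ x) ⊗ₜ (b ⊗ₜ y)) = (a * b) ⊗ₜ (x ⊗ₜ y) := rfl

theorem IsYetterDrinfeld.compat_apply (hD : IsYetterDrinfeld D) (h : H) (x : X) :
    mulAct D (Coalgebra.comul (R := K) h ⊗ₜ D.coact x) =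
      coactActMul D (Coalgebra.comul (R := K) h ⊗ₜ x) :=
  LinearMap.congr_fun hD.compat (h ⊗ₜ x)

theorem IsYetterDrinfeld.of_apply (h₁ : ∀ x : X, D.act (1 ⊗ₜ x) = x)
    (h₂ : ∀ (g h : H) (x : X), D.act ((g * h) ⊗ₜ x) = D.act (g ⊗ₜ D.act (h ⊗ₜ x)))
    (h₃ : ∀ x, TensorProduct.lid K X
      ((Coalgebra.counit (R := K) (A := H)).rTensor X (D.coact x)) = x)
    (h₄ : ∀ x, D.coact.lTensor H (D.coact x) = TensorProduct.assoc K H H X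
      ((Coalgebra.comul (R := K) (A := H)).rTensor X (D.coact x)))
    (h₅ : ∀ (h : H) x, mulAct D (Coalgebra.comul (R := K) h ⊗ₜ D.coact x) =
      coactActMul D (Coalgebra.comul (R := K) h ⊗ₜ x)) : IsYetterDrinfeld D :=
  ⟨h₁, h₂, LinearMap.ext h₃, LinearMap.ext h₄, TensorProduct.ext' h₅⟩

/-- An object which is spanned by the images of morphisms from Yetter-Drinfeld modules is a
Yetter-Drinfeld module. -/
theorem IsYetterDrinfeld.of_span {ι : Type*} {A : ι → Type*} [∀ i, AddCommMonoid (A i)]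
    [∀ i, Module K (A i)] {D : ∀ i, ActCoact K H (A i)} {f : ∀ i, A i →ₗ[K] Y}
    (hf : ∀ i, IsMorphism (D i) E (f i)) (hD : ∀ i, IsYetterDrinfeld (D i))
    (hspan : ∀ p : Y → Prop, (zero : p 0) → (add : ∀ a b, p a → p b → p (a + b)) →
      (map : ∀ i x, p (f i x)) → ∀ y, p y) : IsYetterDrinfeld E := by
  refine .of_apply (fun y => ?_) (fun g h y => ?_) (fun y => ?_) (fun y => ?_) (fun h y => ?_)
  · induction y using hspan with
    | map i x =>
      have h1 := (hf i).apply_act (1 ⊗ₜ x)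
      rw [LinearMap.lTensor_tmul, (hD i).one_act] at h1
      exact h1.symm
    | zero => simp
    | add a b ha hb => simp only [map_add, tmul_add, ha, hb]
  · induction y using hspan with
    | map i x =>
      have h1 := fun g x => (hf i).apply_act (g ⊗ₜ x)
      simp only [LinearMap.lTensor_tmul] at h1
      rw [← h1, ← h1, ← h1, (hD i).mul_act]
    | zero => simp
    | add a b ha hb => simp only [map_add, tmul_add, ha, hb]
  · induction y using hspan with
    | map i x =>
      conv_rhs => rw [← (hD i).counit_coact_apply x]
      rw [(hf i).coact_apply]
      generalize (D i).coact x = u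
      induction u using TensorProduct.induction_on with
      | zero => simp
      | add u v hu hv => simp only [map_add, hu, hv]
      | tmul a x => simp
    | zero => simp
    | add a b ha hb => simp only [map_add, ha, hb]
  · induction y using hspan with
    | map i x =>
      have h1 : ∀ u, E.coact.lTensor H ((f i).lTensor H u) =
          ((f i).lTensor H).lTensor H ((D i).coact.lTensor H u) := fun u => by
        rw [← LinearMap.lTensor_comp_apply, ← LinearMap.lTensor_comp_apply, (hf i).map_coact]
      rw [(hf i).coact_apply, h1, (hD i).coassoc_apply]
      generalize (D i).coact x = u
      induction u using TensorProduct.induction_on with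
      | zero => simp
      | add u v hu hv => simp only [map_add, hu, hv]
      | tmul a x =>
        simp only [LinearMap.rTensor_tmul, LinearMap.lTensor_tmul]
        generalize Coalgebra.comul (R := K) a = c
        induction c using TensorProduct.induction_on with
        | zero => simp
        | add u v hu hv => simp only [map_add, add_tmul, hu, hv]
        | tmul a b => simp
    | zero => simp
    | add a b ha hb => simp only [map_add, ha, hb]
  · induction y using hspan with
    | map i x =>
      have h1 : ∀ c u, mulAct E (c ⊗ₜ (f i).lTensor H u) = (f i).lTensor H
          (mulAct (D i) (c ⊗ₜ u)) := fun c u => by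
        induction c using TensorProduct.induction_on with
        | zero => simp
        | add u v hu hv => simp only [map_add, add_tmul, hu, hv]
        | tmul a b =>
        induction u using TensorProduct.induction_on with
        | zero => simp
        | add u v hu hv => simp only [map_add, tmul_add, hu, hv]
        | tmul a b => simp [(hf i).apply_act]
      rw [(hf i).coact_apply, h1, (hD i).compat_apply]
      generalize Coalgebra.comul (R := K) h = c
      induction c using TensorProduct.induction_on with
      | zero => simp
      | add u v hu hv => simp only [map_add, add_tmul, hu, hv]
      | tmul a b =>
        have h2 : ∀ x, E.act (a ⊗ₜ f i x) = f i ((D i).act (a ⊗ₜ x)) := fun x => by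
          simp [(hf i).apply_act]
        rw [coactActMul_tmul, coactActMul_tmul, h2, (hf i).coact_apply]
        generalize (D i).coact _ = u
        induction u using TensorProduct.induction_on with
        | zero => simp
        | add u v hu hv => simp only [map_add, add_tmul, hu, hv]
        | tmul a b => simp
    | zero => simp
    | add a b ha hb => simp only [map_add, tmul_add, ha, hb]

theorem IsYetterDrinfeld.transport (hD : IsYetterDrinfeld D) (e : X ≃ₗ[K] Y) :
    IsYetterDrinfeld (D.transport e) :=
  .of_span (ι := Unit) (fun _ => isMorphism_transport D e) (fun _ => hD) fun p _ _ h y => by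
    simpa using h () (e.symm y)

theorem directSum_act {A : ℕ → Type*} [∀ n, AddCommMonoid (A n)] [∀ n, Module K (A n)]
    (D : ∀ n, ActCoact K H (A n)) (n : ℕ) (h : H) (x : A n) :
    (ActCoact.directSum D).act (h ⊗ₜ DirectSum.lof K ℕ A n x) =
      DirectSum.lof K ℕ A n ((D n).act (h ⊗ₜ x)) := by
  simp [ActCoact.directSum]

theorem isMorphism_lof {A : ℕ → Type*} [∀ n, AddCommMonoid (A n)] [∀ n, Module K (A n)]
    (D : ∀ n, ActCoact K H (A n)) (n : ℕ) :
    IsMorphism (D n) (ActCoact.directSum D) (DirectSum.lof K ℕ A n) :=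
  .of_apply (fun h x => (directSum_act D n h x).symm) fun x => by simp [ActCoact.directSum]

theorem IsYetterDrinfeld.directSum {A : ℕ → Type*} [∀ n, AddCommMonoid (A n)]
    [∀ n, Module K (A n)] {D : ∀ n, ActCoact K H (A n)} (hD : ∀ n, IsYetterDrinfeld (D n)) :
    IsYetterDrinfeld (ActCoact.directSum D) :=
  .of_span (isMorphism_lof D) hD fun _ h0 hadd h y =>
    DirectSum.induction_on y h0 h fun a b => hadd a b

theorem isYetterDrinfeld_unit : IsYetterDrinfeld (ActCoact.unit (K := K) (H := H)) := by
  refine .of_apply (fun y => ?_) (fun g h y => ?_) (fun y => ?_) (fun y => ?_) (fun h y => ?_)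
  · simp [ActCoact.unit]
  · simp [ActCoact.unit, mul_assoc]
  · simp [ActCoact.unit]
  · simp [ActCoact.unit, Algebra.TensorProduct.one_def]
  · have h1 : ∀ c : H ⊗[K] H, mulAct (ActCoact.unit (K := K)) (c ⊗ₜ[K] (1 ⊗ₜ[K] y)) =
        TensorProduct.rid K H ((Coalgebra.counit (R := K)).lTensor H c) ⊗ₜ y := fun c => by
      induction c using TensorProduct.induction_on with
      | zero => simp
      | add u v hu hv => simp only [map_add, add_tmul, hu, hv]
      | tmul a b => simp [ActCoact.unit, ← smul_tmul', ← tmul_smul]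
    have h2 : ∀ c : H ⊗[K] H, coactActMul (ActCoact.unit (K := K)) (c ⊗ₜ[K] y) =
        TensorProduct.lid K H ((Coalgebra.counit (R := K)).rTensor H c) ⊗ₜ y := fun c => by
      induction c using TensorProduct.induction_on with
      | zero => simp
      | add u v hu hv => simp only [map_add, add_tmul, hu, hv]
      | tmul a b => simp [ActCoact.unit, ← smul_tmul', ← tmul_smul]
    refine (h1 _).trans (Eq.trans ?_ (h2 _).symm)
    rw [Coalgebra.rTensor_counit_comul, Coalgebra.lTensor_counit_comul]
    simp

/-- The map `m ↦ a ⊗ m · y`, for a fixed element `a ⊗ y` of `H ⊗ Y`. -/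
noncomputable def actRight (E : ActCoact K H Y) (v : H ⊗[K] Y) : H →ₗ[K] H ⊗[K] Y :=
  E.act.lTensor H ∘ₗ (leftComm K H H Y).toLinearMap ∘ₗ (TensorProduct.mk K H (H ⊗[K] Y)).flip v

theorem actRight_apply (E : ActCoact K H Y) (v : H ⊗[K] Y) (m : H) :
    actRight E v m = E.act.lTensor H (leftComm K H H Y (m ⊗ₜ v)) := rfl

/-- Starting from `h₍₁₎ x₍₋₁₎ y₍₋₁₎ ⊗ h₍₂₎ x₍₀₎ ⊗ h₍₃₎ y₍₀₎`, compatibility for `x` carries the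
second leg of `h` past `x₍₋₁₎`, and compatibility for `y` carries the third leg past `y₍₋₁₎`. The
result is `(h₍₁₎ x)₍₋₁₎ (h₍₂₎ y)₍₋₁₎ h₍₃₎ ⊗ (h₍₁₎ x)₍₀₎ ⊗ (h₍₂₎ y)₍₀₎`. Coassociativity of `H`
regroups the three legs between these moves. -/
theorem IsYetterDrinfeld.tensor_compat (hD : IsYetterDrinfeld D) (hE : IsYetterDrinfeld E)
    (h : H) (x : X) (y : Y) :
    mulAct (D.tensor E) (Coalgebra.comul (R := K) h ⊗ₜ (D.tensor E).coact (x ⊗ₜ y)) =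
      coactActMul (D.tensor E) (Coalgebra.comul (R := K) h ⊗ₜ (x ⊗ₜ y)) := by
  have hD' : mulAct D ∘ₗ (TensorProduct.mk K _ _).flip (D.coact x) ∘ₗ Coalgebra.comul =
      coactActMul D ∘ₗ (TensorProduct.mk K _ _).flip x ∘ₗ Coalgebra.comul :=
    LinearMap.ext fun h => hD.compat_apply h x
  have hE' : mulAct E ∘ₗ (TensorProduct.mk K _ _).flip (E.coact y) ∘ₗ Coalgebra.comul =
      coactActMul E ∘ₗ (TensorProduct.mk K _ _).flip y ∘ₗ Coalgebra.comul :=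
    LinearMap.ext fun h => hE.compat_apply h y
  -- Isolates the legs `h₍₁₎, h₍₂₎` acting on the `X` part as an instance of `mulAct D`, so that
  -- `hD'` applies.
  have s1 : ∀ (c : H ⊗[K] H) (u : H ⊗[K] X) (v : H ⊗[K] Y),
      mulAct (D.tensor E) (c ⊗ₜ mulTensor H X Y (u ⊗ₜ v)) =
        mulTensor H X Y (map (mulAct D ∘ₗ (TensorProduct.mk K _ _).flip u) (actRight E v)
          ((TensorProduct.assoc K H H H).symm (Coalgebra.comul.lTensor H c))) := by
    intro c u v
    induction c using TensorProduct.induction_on with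
    | zero => simp
    | add u v hu hv => simp only [map_add, add_tmul, hu, hv]
    | tmul a b =>
    induction u using TensorProduct.induction_on with
    | zero => simp [map_zero_left]
    | add u v hu hv => simp only [map_add, add_tmul, tmul_add, hu, hv, LinearMap.comp_add,
        TensorProduct.map_add_left, LinearMap.add_apply]
    | tmul a' x =>
    induction v using TensorProduct.induction_on with
    | zero => simp [actRight, map_zero_right]
    | add u v hu hv =>
      have : actRight E (u + v) = actRight E u + actRight E v := by
        simp [actRight, LinearMap.comp_add]
      simp only [map_add, tmul_add, hu, hv, this, TensorProduct.map_add_right, LinearMap.add_apply]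
    | tmul b' y =>
    simp only [mulTensor_tmul, mulAct_tmul, LinearMap.lTensor_tmul, ActCoact.tensor_act_tmul]
    generalize Coalgebra.comul (R := K) b = c
    induction c using TensorProduct.induction_on with
    | zero => simp
    | add u v hu hv => simp only [map_add, add_tmul, tmul_add, hu, hv]
    | tmul a b => simp [actRight_apply, mul_assoc]
  -- The factor `h₍₂₎` left over by the first move is passed to the `Y` part, where with `h₍₃₎` it
  -- forms an instance of `mulAct E`.
  have s3 : ∀ (c : H ⊗[K] H) (v : H ⊗[K] Y),
      mulTensor H X Y (map (coactActMul D ∘ₗ (TensorProduct.mk K _ _).flip x) (actRight E v)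
        ((TensorProduct.assoc K H H H).symm (Coalgebra.comul.lTensor H c))) =
      mulTensor H X Y (map (D.coact ∘ₗ D.act ∘ₗ (TensorProduct.mk K _ _).flip x)
        (mulAct E ∘ₗ (TensorProduct.mk K _ _).flip v ∘ₗ Coalgebra.comul) c) := by
    intro c v
    induction c using TensorProduct.induction_on with
    | zero => simp
    | add u v hu hv => simp only [map_add, hu, hv]
    | tmul a b =>
    simp only [LinearMap.lTensor_tmul, map_tmul, LinearMap.comp_apply]
    generalize Coalgebra.comul (R := K) b = c
    induction c using TensorProduct.induction_on with
    | zero => simp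
    | add u v hu hv => simp only [map_add, tmul_add, hu, hv]
    | tmul b c =>
    simp only [assoc_symm_tmul, map_tmul, LinearMap.comp_apply, LinearMap.flip_apply, mk_apply,
      coactActMul_tmul]
    generalize D.coact _ = w
    induction w using TensorProduct.induction_on with
    | zero => simp
    | add u v hu hv => simp only [map_add, add_tmul, hu, hv]
    | tmul a x =>
    rw [actRight_apply]
    induction v using TensorProduct.induction_on with
    | zero => simp
    | add u v hu hv => simp only [map_add, tmul_add, hu, hv]
    | tmul d y => simp [mul_assoc]
  -- After the second move `h₍₃₎` stands at the far right, and what precedes it is the diagonal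
  -- coaction of `h₍₁₎ x ⊗ h₍₂₎ y`.
  have s4 : ∀ (c : H ⊗[K] H), mulTensor H X Y (map (D.coact ∘ₗ D.act ∘ₗ (TensorProduct.mk K _ _).flip x)
        (coactActMul E ∘ₗ (TensorProduct.mk K _ _).flip y) (Coalgebra.comul.lTensor H c)) =
      mulRight H (X ⊗[K] Y) (((D.tensor E).coact ∘ₗ map D.act E.act ∘ₗ
        (tensorTensorTensorComm K H H X Y).toLinearMap ∘ₗ (TensorProduct.mk K _ _).flip (x ⊗ₜ y)).rTensor H
        ((TensorProduct.assoc K H H H).symm (Coalgebra.comul.lTensor H c))) := by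
    intro c
    induction c using TensorProduct.induction_on with
    | zero => simp
    | add u v hu hv => simp only [map_add, hu, hv]
    | tmul a b =>
    simp only [LinearMap.lTensor_tmul]
    generalize Coalgebra.comul (R := K) b = c
    induction c using TensorProduct.induction_on with
    | zero => simp
    | add u v hu hv => simp only [map_add, tmul_add, hu, hv]
    | tmul b c =>
    simp only [assoc_symm_tmul, map_tmul, LinearMap.comp_apply, LinearMap.flip_apply, mk_apply,
      coactActMul_tmul, LinearMap.rTensor_tmul, LinearEquiv.coe_coe, tensorTensorTensorComm_tmul,
      ActCoact.tensor_coact_tmul]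
    generalize D.coact _ = u
    generalize E.coact _ = v
    induction u using TensorProduct.induction_on with
    | zero => simp
    | add u v hu hv => simp only [map_add, add_tmul, hu, hv]
    | tmul a x =>
    induction v using TensorProduct.induction_on with
    | zero => simp
    | add u v hu hv => simp only [map_add, add_tmul, tmul_add, hu, hv]
    | tmul d y => simp [mul_assoc]
  have s5 : ∀ (c : H ⊗[K] H), coactActMul (D.tensor E) (c ⊗ₜ (x ⊗ₜ y)) =
      mulRight H (X ⊗[K] Y) (((D.tensor E).coact ∘ₗ map D.act E.act ∘ₗ
        (tensorTensorTensorComm K H H X Y).toLinearMap ∘ₗ (TensorProduct.mk K _ _).flip (x ⊗ₜ y)).rTensor H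
        (Coalgebra.comul.rTensor H c)) := by
    intro c
    induction c using TensorProduct.induction_on with
    | zero => simp
    | add u v hu hv => simp only [map_add, add_tmul, hu, hv]
    | tmul a b => rfl
  have hq : (D.tensor E).coact (x ⊗ₜ y) = mulTensor H X Y (D.coact x ⊗ₜ E.coact y) := rfl
  have m1 : ∀ {A B : Type _} [AddCommMonoid A] [Module K A] [AddCommMonoid B] [Module K B]
      (f : H ⊗[K] H →ₗ[K] A) (g : H →ₗ[K] B) (c : H ⊗[K] H),
      map f g (Coalgebra.comul.rTensor H c) = map (f ∘ₗ Coalgebra.comul) g c := fun f g c => by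
    rw [LinearMap.rTensor, ← LinearMap.comp_apply, ← map_comp, LinearMap.comp_id]
  have m2 : ∀ {A B : Type _} [AddCommMonoid A] [Module K A] [AddCommMonoid B] [Module K B]
      (f : H →ₗ[K] A) (g : H ⊗[K] H →ₗ[K] B) (c : H ⊗[K] H),
      map f g (Coalgebra.comul.lTensor H c) = map f (g ∘ₗ Coalgebra.comul) c := fun f g c => by
    rw [LinearMap.lTensor, ← LinearMap.comp_apply, ← map_comp, LinearMap.comp_id]
  -- `m1` and `m2` absorb a coproduct into a tensor factor, so that `hD'` and `hE'` can be used as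
  -- identities of linear maps in `h`.
  rw [hq, s1, Coalgebra.coassoc_symm_apply, m1, LinearMap.comp_assoc, hD', ← LinearMap.comp_assoc,
    ← m1, ← Coalgebra.coassoc_symm_apply, s3, hE', ← LinearMap.comp_assoc _ _ (coactActMul E), ← m2,
    s4, Coalgebra.coassoc_symm_apply, s5]

/-- Besides the compatibility, everything rests on `H` being a bialgebra: multiplicativity of the
coproduct gives the module law and the coassociativity of the coaction, and multiplicativity of the
counit gives its counitality. -/
theorem IsYetterDrinfeld.tensor (hD : IsYetterDrinfeld D) (hE : IsYetterDrinfeld E) :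
    IsYetterDrinfeld (D.tensor E) := by
  refine .of_apply (fun u => ?_) (fun g h u => ?_) (fun u => ?_) (fun u => ?_) (fun h u => ?_)
  · induction u using TensorProduct.induction_on with
    | zero => simp
    | add u v hu hv => simp only [map_add, tmul_add, hu, hv]
    | tmul x y =>
      simp [ActCoact.tensor_act_tmul, Algebra.TensorProduct.one_def, hD.one_act, hE.one_act]
  · induction u using TensorProduct.induction_on with
    | zero => simp
    | add u v hu hv => simp only [map_add, tmul_add, hu, hv]
    | tmul x y =>
    simp only [ActCoact.tensor_act_tmul, Bialgebra.comul_mul]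
    generalize Coalgebra.comul (R := K) g = c
    generalize Coalgebra.comul (R := K) h = d
    induction c using TensorProduct.induction_on with
    | zero => simp
    | add u v hu hv => simp only [map_add, add_tmul, add_mul, hu, hv]
    | tmul a b =>
    induction d using TensorProduct.induction_on with
    | zero => simp
    | add u v hu hv => simp only [map_add, add_tmul, tmul_add, mul_add, hu, hv]
    | tmul a b => simp [hD.mul_act, hE.mul_act]
  · induction u using TensorProduct.induction_on with
    | zero => simp
    | add u v hu hv => simp only [map_add, hu, hv]
    | tmul x y =>
    conv_rhs => rw [← hD.counit_coact_apply x, ← hE.counit_coact_apply y]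
    rw [ActCoact.tensor_coact_tmul]
    generalize D.coact x = u
    generalize E.coact y = v
    induction u using TensorProduct.induction_on with
    | zero => simp
    | add u v hu hv => simp only [map_add, add_tmul, hu, hv]
    | tmul a x =>
    induction v using TensorProduct.induction_on with
    | zero => simp
    | add u v hu hv => simp only [map_add, tmul_add, hu, hv]
    | tmul d y => simp [← smul_tmul', smul_smul, mul_comm]
  · induction u using TensorProduct.induction_on with
    | zero => simp
    | add u v hu hv => simp only [map_add, hu, hv]
    | tmul x y =>
    -- `Ξ` multiplies two iterated coactions leg by leg. Both sides of coassociativity are `Ξ` of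
    -- the corresponding sides for `x` and `y`.
    let Ξ : (H ⊗[K] (H ⊗[K] X)) ⊗[K] (H ⊗[K] (H ⊗[K] Y)) →ₗ[K] H ⊗[K] (H ⊗[K] (X ⊗[K] Y)) :=
      map (LinearMap.mul' K H) (mulTensor H X Y) ∘ₗ
        (tensorTensorTensorComm K H (H ⊗[K] X) H (H ⊗[K] Y)).toLinearMap
    have hΞ : ∀ a u b v, Ξ ((a ⊗ₜ u) ⊗ₜ (b ⊗ₜ v)) = (a * b) ⊗ₜ mulTensor H X Y (u ⊗ₜ v) :=
      fun a u b v => rfl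
    have h1 : ∀ u v, (D.tensor E).coact.lTensor H (mulTensor H X Y (u ⊗ₜ v)) =
        Ξ (D.coact.lTensor H u ⊗ₜ E.coact.lTensor H v) := fun u v => by
      induction u using TensorProduct.induction_on with
      | zero => simp
      | add u v hu hv => simp only [map_add, add_tmul, hu, hv]
      | tmul a x =>
      induction v using TensorProduct.induction_on with
      | zero => simp
      | add u v hu hv => simp only [map_add, tmul_add, hu, hv]
      | tmul d y => rfl
    have h2 : ∀ u v, TensorProduct.assoc K H H (X ⊗[K] Y)
        ((Coalgebra.comul (R := K) (A := H)).rTensor _ (mulTensor H X Y (u ⊗ₜ v))) =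
        Ξ (TensorProduct.assoc K H H X ((Coalgebra.comul (R := K)).rTensor X u) ⊗ₜ
          TensorProduct.assoc K H H Y ((Coalgebra.comul (R := K)).rTensor Y v)) := fun u v => by
      induction u using TensorProduct.induction_on with
      | zero => simp
      | add u v hu hv => simp only [map_add, add_tmul, hu, hv]
      | tmul a x =>
      induction v using TensorProduct.induction_on with
      | zero => simp
      | add u v hu hv => simp only [map_add, tmul_add, hu, hv]
      | tmul b y =>
      simp only [mulTensor_tmul, LinearMap.rTensor_tmul, Bialgebra.comul_mul]
      generalize Coalgebra.comul (R := K) a = c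
      generalize Coalgebra.comul (R := K) b = d
      induction c using TensorProduct.induction_on with
      | zero => simp
      | add u v hu hv => simp only [map_add, add_tmul, add_mul, hu, hv]
      | tmul a b =>
      induction d using TensorProduct.induction_on with
      | zero => simp
      | add u v hu hv => simp only [map_add, add_tmul, tmul_add, mul_add, hu, hv]
      | tmul a b => simp [hΞ]
    have h3 := h1 (D.coact x) (E.coact y)
    rw [hD.coassoc_apply, hE.coassoc_apply, ← h2] at h3
    exact h3
  · induction u using TensorProduct.induction_on with
    | zero => simp
    | add u v hu hv => simp only [map_add, tmul_add, hu, hv]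
    | tmul x y => exact hD.tensor_compat hE h x y

end YetterDrinfeld

end YD

section YD

variable {K H : Type*} [Field K] [Ring H] [HopfAlgebra K H]
variable {X Y Z X' Y' Z' A B : Type*} [AddCommMonoid X] [Module K X] [AddCommMonoid Y] [Module K Y]
  [AddCommMonoid Z] [Module K Z] [AddCommMonoid X'] [Module K X'] [AddCommMonoid Y'] [Module K Y']
  [AddCommMonoid Z'] [Module K Z'] [AddCommMonoid A] [Module K A] [AddCommMonoid B] [Module K B]

/-! ### The braiding -/

section Braid

/-- The braiding `x ⊗ y ↦ x₍₋₁₎ · y ⊗ x₍₀₎` of two objects. -/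
noncomputable def braid (D : ActCoact K H X) (E : ActCoact K H Y) : X ⊗[K] Y →ₗ[K] Y ⊗[K] X :=
  E.act.rTensor X ∘ₗ (rightComm K H X Y).toLinearMap ∘ₗ D.coact.rTensor Y

theorem braid_tmul (D : ActCoact K H X) (E : ActCoact K H Y) (x : X) (y : Y) :
    braid D E (x ⊗ₜ y) = E.act.rTensor X (rightComm K H X Y (D.coact x ⊗ₜ y)) := rfl

theorem naturalBraiding_eq_braid (D : ActCoact K H X) : naturalBraiding D = braid D D := rfl

variable {D : ActCoact K H X} {E : ActCoact K H Y} {F : ActCoact K H Z}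
  {D' : ActCoact K H X'} {E' : ActCoact K H Y'} {F' : ActCoact K H Z'}

/-- Naturality: the coaction passes through `f` and the action through `g`. This is what lets the
operations slide through crossings. -/
theorem braid_map {f : X →ₗ[K] X'} {g : Y →ₗ[K] Y'} (hf : IsMorphism D D' f)
    (hg : IsMorphism E E' g) (u : X ⊗[K] Y) :
    braid D' E' (map f g u) = map g f (braid D E u) := by
  induction u using TensorProduct.induction_on with
  | zero => simp
  | add u v hu hv => simp only [map_add, hu, hv]
  | tmul x y =>
  rw [map_tmul, braid_tmul, hf.coact_apply, braid_tmul]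
  generalize D.coact x = u
  induction u using TensorProduct.induction_on with
  | zero => simp
  | add u v hu hv => simp only [map_add, add_tmul, hu, hv]
  | tmul a x => simp [hg.apply_act]

/-- A hexagon: the coaction of `x ⊗ y` has first leg `x₍₋₁₎ y₍₋₁₎`, and acting by a product is
acting twice. -/
theorem braid_tensor_left (D : ActCoact K H X) (E : ActCoact K H Y) (hF : IsYetterDrinfeld F)
    (x : X) (y : Y) (z : Z) :
    braid (D.tensor E) F ((x ⊗ₜ y) ⊗ₜ z) = TensorProduct.assoc K Z X Y
      ((braid D F).rTensor Y ((TensorProduct.assoc K X Z Y).symm (x ⊗ₜ braid E F (y ⊗ₜ z)))) := by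
  simp only [braid_tmul, ActCoact.tensor_coact_tmul]
  generalize E.coact y = v
  induction v using TensorProduct.induction_on with
  | zero => simp
  | add u v hu hv => simp only [map_add, add_tmul, tmul_add, hu, hv]
  | tmul b y =>
  simp only [rightComm_tmul, LinearMap.rTensor_tmul, assoc_symm_tmul, braid_tmul]
  generalize D.coact x = u
  induction u using TensorProduct.induction_on with
  | zero => simp
  | add u v hu hv => simp only [map_add, add_tmul, hu, hv]
  | tmul a x => simp [hF.mul_act]

/-- The other hexagon: acting diagonally by `x₍₋₁₎` splits it by the coproduct, and coassociativity
of the coaction turns this into coacting twice. -/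
theorem braid_tensor_right (hD : IsYetterDrinfeld D) (E : ActCoact K H Y) (F : ActCoact K H Z)
    (x : X) (y : Y) (z : Z) :
    braid D (E.tensor F) (x ⊗ₜ (y ⊗ₜ z)) = (TensorProduct.assoc K Y Z X).symm
      ((braid D F).lTensor Y (TensorProduct.assoc K Y X Z (braid D E (x ⊗ₜ y) ⊗ₜ z))) := by
  -- `L` sends `a ⊗ (b ⊗ x)` to `(a · y ⊗ b · z) ⊗ x`; the two sides are `L` of the two iterated
  -- coactions of `x`.
  let L : H ⊗[K] (H ⊗[K] X) →ₗ[K] (Y ⊗[K] Z) ⊗[K] X :=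
    (TensorProduct.assoc K Y Z X).symm.toLinearMap ∘ₗ
      map (E.act ∘ₗ (TensorProduct.mk K H Y).flip y)
        (F.act.rTensor X ∘ₗ (rightComm K H X Z).toLinearMap ∘ₗ
          (TensorProduct.mk K (H ⊗[K] X) Z).flip z)
  have h1 : ∀ u, (E.tensor F).act.rTensor X (rightComm K H X _ (u ⊗ₜ (y ⊗ₜ z))) =
      L (TensorProduct.assoc K H H X (Coalgebra.comul.rTensor X u)) := fun u => by
    induction u using TensorProduct.induction_on with
    | zero => simp
    | add u v hu hv => simp only [map_add, add_tmul, hu, hv]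
    | tmul a x =>
    simp only [rightComm_tmul, LinearMap.rTensor_tmul, ActCoact.tensor_act_tmul]
    generalize Coalgebra.comul (R := K) a = c
    induction c using TensorProduct.induction_on with
    | zero => simp
    | add u v hu hv => simp only [map_add, add_tmul, hu, hv]
    | tmul a b => simp [L]
  have h2 : ∀ u, (TensorProduct.assoc K Y Z X).symm ((braid D F).lTensor Y
      (TensorProduct.assoc K Y X Z (E.act.rTensor X (rightComm K H X _ (u ⊗ₜ y)) ⊗ₜ z))) =
      L (D.coact.lTensor H u) := fun u => by
    induction u using TensorProduct.induction_on with
    | zero => simp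
    | add u v hu hv => simp only [map_add, add_tmul, hu, hv]
    | tmul a x => simp [L, braid_tmul]
  rw [braid_tmul, braid_tmul, h1, h2, hD.coassoc_apply]

theorem braid_unit_left (hD : IsYetterDrinfeld D) (r : K) (x : X) :
    braid ActCoact.unit D (r ⊗ₜ x) = x ⊗ₜ r := by
  simp [braid_tmul, ActCoact.unit, hD.one_act]

theorem braid_unit_right (hD : IsYetterDrinfeld D) (x : X) (r : K) :
    braid D ActCoact.unit (x ⊗ₜ r) = r ⊗ₜ x := by
  conv_rhs => rw [← hD.counit_coact_apply x]
  rw [braid_tmul]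
  generalize D.coact x = u
  induction u using TensorProduct.induction_on with
  | zero => simp
  | add u v hu hv => simp only [map_add, add_tmul, tmul_add, hu, hv]
  | tmul a x => simp [ActCoact.unit, smul_tmul']

/-- Linearity comes from the compatibility of `X`, rewriting `(h₍₁₎ x)₍₋₁₎ h₍₂₎` before it acts on
`y`. Colinearity comes from the compatibility of `Y`, applied to the element `x₍₋₁₎` after
coassociativity has split it in two. -/
theorem isMorphism_braid (hD : IsYetterDrinfeld D) (hE : IsYetterDrinfeld E) :
    IsMorphism (D.tensor E) (E.tensor D) (braid D E) := by
  refine .of_apply (fun h u => ?_) fun u => ?_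
  · induction u using TensorProduct.induction_on with
    | zero => simp
    | add u v hu hv => simp only [map_add, tmul_add, hu, hv]
    | tmul x y =>
    let L : H ⊗[K] X →ₗ[K] Y ⊗[K] X :=
      E.act.rTensor X ∘ₗ (rightComm K H X Y).toLinearMap ∘ₗ (TensorProduct.mk K (H ⊗[K] X) Y).flip y
    have h1 : ∀ c, braid D E (map D.act E.act (tensorTensorTensorComm K H H X Y
        (c ⊗ₜ (x ⊗ₜ y)))) = L (coactActMul D (c ⊗ₜ x)) := fun c => by
      induction c using TensorProduct.induction_on with
      | zero => simp
      | add u v hu hv => simp only [map_add, add_tmul, hu, hv]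
      | tmul a b =>
      simp only [tensorTensorTensorComm_tmul, map_tmul, braid_tmul, coactActMul_tmul]
      generalize D.coact _ = u
      induction u using TensorProduct.induction_on with
      | zero => simp
      | add u v hu hv => simp only [map_add, add_tmul, hu, hv]
      | tmul a x => simp [L, hE.mul_act]
    rw [ActCoact.tensor_act_tmul, h1, ← hD.compat_apply, ActCoact.tensor_act_tmul, braid_tmul]
    generalize Coalgebra.comul (R := K) h = c
    generalize D.coact x = u
    induction c using TensorProduct.induction_on with
    | zero => simp
    | add u v hu hv => simp only [map_add, add_tmul, hu, hv]
    | tmul a b =>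
    induction u using TensorProduct.induction_on with
    | zero => simp
    | add u v hu hv => simp only [map_add, add_tmul, tmul_add, hu, hv]
    | tmul a x => simp [L, hE.mul_act]
  · induction u using TensorProduct.induction_on with
    | zero => simp
    | add u v hu hv => simp only [map_add, hu, hv]
    | tmul x y =>
    -- `L` and `L'` are the two sides of the compatibility for `y`, with `x` carried along; they
    -- agree on images of the coproduct, which is `h2`.
    let L : (H ⊗[K] H) ⊗[K] X →ₗ[K] H ⊗[K] (Y ⊗[K] X) :=
      (TensorProduct.assoc K H Y X).toLinearMap ∘ₗ (coactActMul E).rTensor X ∘ₗ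
        (rightComm K (H ⊗[K] H) X Y).toLinearMap ∘ₗ
        (TensorProduct.mk K ((H ⊗[K] H) ⊗[K] X) Y).flip y
    let L' : (H ⊗[K] H) ⊗[K] X →ₗ[K] H ⊗[K] (Y ⊗[K] X) :=
      (TensorProduct.assoc K H Y X).toLinearMap ∘ₗ (mulAct E).rTensor X ∘ₗ
        (rightComm K (H ⊗[K] H) X (H ⊗[K] Y)).toLinearMap ∘ₗ
        (TensorProduct.mk K ((H ⊗[K] H) ⊗[K] X) (H ⊗[K] Y)).flip (E.coact y)
    have h1 : ∀ u, (E.tensor D).coact (E.act.rTensor X (rightComm K H X Y (u ⊗ₜ y))) =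
        L ((TensorProduct.assoc K H H X).symm (D.coact.lTensor H u)) := fun u => by
      induction u using TensorProduct.induction_on with
      | zero => simp
      | add u v hu hv => simp only [map_add, add_tmul, hu, hv]
      | tmul a x =>
      simp only [rightComm_tmul, LinearMap.rTensor_tmul, ActCoact.tensor_coact_tmul,
        LinearMap.lTensor_tmul]
      generalize D.coact x = u
      induction u using TensorProduct.induction_on with
      | zero => simp
      | add u v hu hv => simp only [map_add, tmul_add, hu, hv]
      | tmul b x =>
      simp only [L, LinearMap.comp_apply, LinearEquiv.coe_coe, assoc_symm_tmul,
        LinearMap.flip_apply, TensorProduct.mk_apply, rightComm_tmul, LinearMap.rTensor_tmul,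
        coactActMul_tmul]
      generalize E.coact _ = v
      induction v using TensorProduct.induction_on with
      | zero => simp
      | add u v hu hv => simp only [map_add, add_tmul, hu, hv]
      | tmul d y => simp
    have h2 : ∀ u, L ((Coalgebra.comul (R := K) (A := H)).rTensor X u) =
        L' ((Coalgebra.comul (R := K) (A := H)).rTensor X u) := fun u => by
      induction u using TensorProduct.induction_on with
      | zero => simp
      | add u v hu hv => simp only [map_add, hu, hv]
      | tmul a x => simp [L, L', hE.compat_apply]
    have h3 : ∀ u, (braid D E).lTensor H (mulTensor H X Y (u ⊗ₜ E.coact y)) =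
        L' ((TensorProduct.assoc K H H X).symm (D.coact.lTensor H u)) := fun u => by
      simp only [L']
      generalize E.coact y = v
      induction u using TensorProduct.induction_on with
      | zero => simp
      | add u v hu hv => simp only [map_add, add_tmul, hu, hv]
      | tmul a x =>
      induction v using TensorProduct.induction_on with
      | zero => simp
      | add u v hu hv =>
        simp only [map_add, tmul_add, hu, hv, LinearMap.comp_add, LinearMap.add_apply]
      | tmul b y =>
      simp only [mulTensor_tmul, LinearMap.lTensor_tmul, braid_tmul]
      generalize D.coact x = u
      induction u using TensorProduct.induction_on with
      | zero => simp
      | add u v hu hv => simp only [map_add, add_tmul, tmul_add, hu, hv]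
      | tmul c x => simp
    have hq : (D.tensor E).coact (x ⊗ₜ y) = mulTensor H X Y (D.coact x ⊗ₜ E.coact y) := rfl
    rw [braid_tmul, h1, hq, h3, hD.coassoc_apply, LinearEquiv.symm_apply_apply, h2]

/-! ### The braided interchange -/

/-- The map `id ⊗ c ⊗ id : (A ⊗ X) ⊗ (Y ⊗ B) → (A ⊗ Y) ⊗ (X ⊗ B)`, with `c` the braiding. -/
noncomputable def braidMid (A B : Type*) [AddCommMonoid A] [Module K A] [AddCommMonoid B]
    [Module K B] (D : ActCoact K H X) (E : ActCoact K H Y) :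
    (A ⊗[K] X) ⊗[K] (Y ⊗[K] B) →ₗ[K] (A ⊗[K] Y) ⊗[K] (X ⊗[K] B) :=
  (regroup (K := K) A Y X B).symm.toLinearMap ∘ₗ
    ((braid D E).rTensor B).lTensor A ∘ₗ (regroup (K := K) A X Y B).toLinearMap

@[simp]
theorem regroup_tmul (a : A) (x : X) (y : Y) (b : B) :
    regroup (K := K) A X Y B ((a ⊗ₜ x) ⊗ₜ (y ⊗ₜ b)) = a ⊗ₜ ((x ⊗ₜ y) ⊗ₜ b) := rfl

@[simp]
theorem regroup_symm_tmul (a : A) (x : X) (y : Y) (b : B) :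
    (regroup (K := K) A X Y B).symm (a ⊗ₜ ((x ⊗ₜ y) ⊗ₜ b)) = (a ⊗ₜ x) ⊗ₜ (y ⊗ₜ b) := rfl

theorem braidMid_tmul (a : A) (x : X) (y : Y) (b : B) :
    braidMid A B D E ((a ⊗ₜ x) ⊗ₜ (y ⊗ₜ b)) =
      (regroup (K := K) A Y X B).symm (a ⊗ₜ (braid D E (x ⊗ₜ y) ⊗ₜ b)) := rfl

variable {A' B' : Type*} [AddCommMonoid A'] [Module K A'] [AddCommMonoid B'] [Module K B']

theorem braidMid_map (p : A →ₗ[K] A') (q : B →ₗ[K] B') {f : X →ₗ[K] X'} {g : Y →ₗ[K] Y'}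
    (hf : IsMorphism D D' f) (hg : IsMorphism E E' g) (u : (A ⊗[K] X) ⊗[K] (Y ⊗[K] B)) :
    braidMid A' B' D' E' (map (map p f) (map g q) u) =
      map (map p g) (map f q) (braidMid A B D E u) := by
  induction u using TensorProduct.induction_on with
  | zero => simp
  | add u v hu hv => simp only [map_add, hu, hv]
  | tmul u v =>
  induction u using TensorProduct.induction_on with
  | zero => simp
  | add u v hu hv => simp only [map_add, add_tmul, hu, hv]
  | tmul a x =>
  induction v using TensorProduct.induction_on with
  | zero => simp
  | add u v hu hv => simp only [map_add, tmul_add, hu, hv]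
  | tmul y b =>
  simp only [map_tmul, braidMid_tmul]
  rw [← map_tmul f g, braid_map hf hg]
  generalize braid D E _ = u
  induction u using TensorProduct.induction_on with
  | zero => simp
  | add u v hu hv => simp only [map_add, add_tmul, tmul_add, hu, hv]
  | tmul y x => simp

theorem isMorphism_regroup (DA : ActCoact K H A) (D : ActCoact K H X) (E : ActCoact K H Y)
    (DB : ActCoact K H B) : IsMorphism ((DA.tensor D).tensor (E.tensor DB))
      (DA.tensor ((D.tensor E).tensor DB)) (regroup (K := K) A X Y B).toLinearMap :=
  (IsMorphism.id.tensor (isMorphism_assoc D E DB).symm).comp (isMorphism_assoc DA D (E.tensor DB))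

theorem isMorphism_braidMid {DA : ActCoact K H A} {DB : ActCoact K H B} (hD : IsYetterDrinfeld D)
    (hE : IsYetterDrinfeld E) :
    IsMorphism ((DA.tensor D).tensor (E.tensor DB)) ((DA.tensor E).tensor (D.tensor DB))
      (braidMid A B D E) := by
  exact (isMorphism_regroup DA E D DB).symm.comp ((IsMorphism.id.tensor
    ((isMorphism_braid hD hE).tensor .id)).comp (isMorphism_regroup DA D E DB))

/-- Two ways of distributing three tensor factors over three others. -/
theorem braidMid_assoc {D₁ : ActCoact K H X} {D₂ : ActCoact K H X'} {E₁ : ActCoact K H Y}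
    {E₂ : ActCoact K H Y'} (h₂ : IsYetterDrinfeld D₂) (h₁ : IsYetterDrinfeld E₁)
    (u : ((A ⊗[K] X) ⊗[K] X') ⊗[K] ((Y ⊗[K] Y') ⊗[K] B)) :
    TensorProduct.assoc K (A ⊗[K] Y) (X ⊗[K] Y') (X' ⊗[K] B)
      ((braidMid A Y' D₁ E₁).rTensor (X' ⊗[K] B) (braidMid (A ⊗[K] X) B D₂ (E₁.tensor E₂) u)) =
    (braidMid X B D₂ E₂).lTensor (A ⊗[K] Y) (braidMid A (Y' ⊗[K] B) (D₁.tensor D₂) E₁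
      (map (TensorProduct.assoc K A X X').toLinearMap (TensorProduct.assoc K Y Y' B).toLinearMap
        u)) := by
  induction u using TensorProduct.induction_on with
  | zero => simp
  | add u v hu hv => simp only [map_add, hu, hv]
  | tmul u v =>
  induction u using TensorProduct.induction_on with
  | zero => simp
  | add u v hu hv => simp only [map_add, add_tmul, hu, hv]
  | tmul u x' =>
  induction u using TensorProduct.induction_on with
  | zero => simp
  | add u v hu hv => simp only [map_add, add_tmul, hu, hv]
  | tmul a x =>
  induction v using TensorProduct.induction_on with
  | zero => simp
  | add u v hu hv => simp only [map_add, tmul_add, hu, hv]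
  | tmul v b =>
  induction v using TensorProduct.induction_on with
  | zero => simp
  | add u v hu hv => simp only [map_add, tmul_add, add_tmul, hu, hv]
  | tmul y y' =>
  simp only [map_tmul, LinearEquiv.coe_coe, assoc_tmul, braidMid_tmul, braid_tensor_left D₁ D₂ h₁,
    braid_tensor_right h₂ E₁ E₂]
  -- By the hexagons each side consists of the same three crossings. This one comes first on both
  -- sides; the other two act on disjoint factors and so commute.
  generalize braid D₂ E₁ (x' ⊗ₜ y) = u
  induction u using TensorProduct.induction_on with
  | zero => simp
  | add u v hu hv => simp only [map_add, add_tmul, tmul_add, hu, hv]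
  | tmul y x' =>
  simp only [assoc_tmul, assoc_symm_tmul, LinearMap.lTensor_tmul, LinearMap.rTensor_tmul]
  generalize hw : braid D₁ E₁ (x ⊗ₜ y) = w
  generalize hz : braid D₂ E₂ (x' ⊗ₜ y') = z
  -- Rewriting makes the left side visibly linear in `z` with `w` fixed, so that the remaining two
  -- crossings can be expanded one at a time.
  have e1 : (braidMid A Y' D₁ E₁).rTensor (X' ⊗[K] B) ((regroup (K := K) (A ⊗[K] X) (Y ⊗[K] Y')
      X' B).symm ((a ⊗ₜ x) ⊗ₜ ((TensorProduct.assoc K Y Y' X').symm (y ⊗ₜ z) ⊗ₜ b))) =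
      map (regroup (K := K) A Y X Y').symm.toLinearMap .id (map ((TensorProduct.mk K A _ a) ∘ₗ
        TensorProduct.mk K _ _ w) ((TensorProduct.mk K X' B).flip b)
        z) := by
    clear hz
    induction z using TensorProduct.induction_on with
    | zero => simp
    | add u v hu hv => simp only [map_add, add_tmul, tmul_add, hu, hv]
    | tmul y' x' => simp [braidMid_tmul, hw]
  rw [e1]
  clear e1 hw
  induction w using TensorProduct.induction_on with
  | zero => simp
  | add u v hu hv =>
    simp only [map_add, add_tmul, tmul_add, ← hu, ← hv, LinearMap.comp_add, map_add_left,
      LinearMap.add_apply]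
  | tmul y x =>
  simp only [assoc_tmul, regroup_symm_tmul, LinearMap.lTensor_tmul, braidMid_tmul, hz]
  clear hz
  induction z using TensorProduct.induction_on with
  | zero => simp
  | add u v hu hv => simp only [map_add, add_tmul, tmul_add, hu, hv]
  | tmul y' x' => simp

/-! ### Coproducts on tensor products -/

/-- The coproduct `(id ⊗ c ⊗ id) (Δ ⊗ Δ')` of the braided tensor product of coalgebras. -/
noncomputable def tensorComul (D : ActCoact K H X) (E : ActCoact K H Y) (Δ : X →ₗ[K] X ⊗[K] X)
    (Δ' : Y →ₗ[K] Y ⊗[K] Y) : X ⊗[K] Y →ₗ[K] (X ⊗[K] Y) ⊗[K] (X ⊗[K] Y) :=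
  braidMid X Y D E ∘ₗ map Δ Δ'

theorem isMorphism_tensorComul {Δ : X →ₗ[K] X ⊗[K] X} {Δ' : Y →ₗ[K] Y ⊗[K] Y}
    (hD : IsYetterDrinfeld D) (hE : IsYetterDrinfeld E) (hΔ : IsMorphism D (D.tensor D) Δ)
    (hΔ' : IsMorphism E (E.tensor E) Δ') :
    IsMorphism (D.tensor E) ((D.tensor E).tensor (D.tensor E)) (tensorComul D E Δ Δ') :=
  (isMorphism_braidMid hD hE).comp (hΔ.tensor hΔ')

/-- Naturality of the braiding moves `f` and `g` past the middle crossing. Hence the tensor product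
of two coalgebra maps that are morphisms is again a coalgebra map. -/
theorem tensorComul_map {ΔX : X →ₗ[K] X ⊗[K] X} {ΔY : Y →ₗ[K] Y ⊗[K] Y}
    {ΔX' : X' →ₗ[K] X' ⊗[K] X'} {ΔY' : Y' →ₗ[K] Y' ⊗[K] Y'}
    {f : X →ₗ[K] X'} {g : Y →ₗ[K] Y'} (hf : IsMorphism D D' f) (hg : IsMorphism E E' g)
    (hfΔ : ΔX' ∘ₗ f = map f f ∘ₗ ΔX) (hgΔ : ΔY' ∘ₗ g = map g g ∘ₗ ΔY) :
    tensorComul D' E' ΔX' ΔY' ∘ₗ map f g =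
      map (map f g) (map f g) ∘ₗ tensorComul D E ΔX ΔY := by
  rw [tensorComul, LinearMap.comp_assoc, ← map_comp, hfΔ, hgΔ, map_comp]
  exact LinearMap.ext fun u => braidMid_map _ _ hf hg _

/-- The coproducts are morphisms, so the outer application of `Δ` and `Δ'` can be moved in front of
the first crossing. The crossings are then compared by `braidMid_assoc` and the coproducts by their
own coassociativity. -/
theorem tensorComul_coassoc {Δ : X →ₗ[K] X ⊗[K] X} {Δ' : Y →ₗ[K] Y ⊗[K] Y}
    (hD : IsYetterDrinfeld D) (hE : IsYetterDrinfeld E) (hΔ : IsMorphism D (D.tensor D) Δ)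
    (hΔ' : IsMorphism E (E.tensor E) Δ')
    (h : (TensorProduct.assoc K X X X).toLinearMap ∘ₗ Δ.rTensor X ∘ₗ Δ = Δ.lTensor X ∘ₗ Δ)
    (h' : (TensorProduct.assoc K Y Y Y).toLinearMap ∘ₗ Δ'.rTensor Y ∘ₗ Δ' = Δ'.lTensor Y ∘ₗ Δ') :
    (TensorProduct.assoc K _ _ _).toLinearMap ∘ₗ (tensorComul D E Δ Δ').rTensor (X ⊗[K] Y) ∘ₗ
      tensorComul D E Δ Δ' =
    (tensorComul D E Δ Δ').lTensor (X ⊗[K] Y) ∘ₗ tensorComul D E Δ Δ' := by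
  refine LinearMap.ext fun u => ?_
  have n1 := braidMid_map Δ .id (IsMorphism.id (D := D)) hΔ' (map Δ Δ' u)
  have n2 := braidMid_map .id Δ' hΔ (IsMorphism.id (D := E)) (map Δ Δ' u)
  have r : ∀ w, (tensorComul D E Δ Δ').rTensor (X ⊗[K] Y) w =
      (braidMid X Y D E).rTensor (X ⊗[K] Y) (map (map Δ Δ') (map .id .id) w) := fun w => by
    rw [tensorComul, LinearMap.rTensor_comp_apply, map_id]; rfl
  have l : ∀ w, (tensorComul D E Δ Δ').lTensor (X ⊗[K] Y) w =
      (braidMid X Y D E).lTensor (X ⊗[K] Y) (map (map .id .id) (map Δ Δ') w) := fun w => by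
    rw [tensorComul, LinearMap.lTensor_comp_apply, map_id]; rfl
  have e : map (TensorProduct.assoc K X X X).toLinearMap (TensorProduct.assoc K Y Y Y).toLinearMap
      (map (map Δ .id) (map Δ' .id) (map Δ Δ' u)) = map (map .id Δ) (map .id Δ') (map Δ Δ' u) := by
    rw [← LinearMap.comp_apply, ← LinearMap.comp_apply, ← LinearMap.comp_apply, ← map_comp,
      ← map_comp, ← map_comp]
    exact congrArg₂ (fun f g => map f g u) h h'
  simp only [LinearMap.comp_apply, LinearEquiv.coe_coe, r, l]
  rw [tensorComul, LinearMap.comp_apply, ← n1, ← n2, braidMid_assoc hD hE, e]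

/-- By the hexagons both bracketings cross `x₂` with `y₁`, `y₂` with `z₁`, and finally `x₂` with
`z₁`; the first two crossings commute. The coproducts themselves may be arbitrary linear maps. -/
theorem tensorComul_assoc {ΔX : X →ₗ[K] X ⊗[K] X} {ΔY : Y →ₗ[K] Y ⊗[K] Y}
    {ΔZ : Z →ₗ[K] Z ⊗[K] Z} (hD : IsYetterDrinfeld D) (hF : IsYetterDrinfeld F) :
    map (TensorProduct.assoc K X Y Z).toLinearMap (TensorProduct.assoc K X Y Z).toLinearMap ∘ₗ
      tensorComul (D.tensor E) F (tensorComul D E ΔX ΔY) ΔZ =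
    tensorComul D (E.tensor F) ΔX (tensorComul E F ΔY ΔZ) ∘ₗ
      (TensorProduct.assoc K X Y Z).toLinearMap := by
  refine TensorProduct.ext_threefold fun x y z => ?_
  simp only [tensorComul, LinearMap.comp_apply, map_tmul, LinearEquiv.coe_coe, assoc_tmul]
  generalize ΔX x = u
  generalize ΔY y = v
  generalize ΔZ z = w
  induction u using TensorProduct.induction_on with
  | zero => simp
  | add u v hu hv => simp only [map_add, add_tmul, hu, hv]
  | tmul x₁ x₂ =>
  induction v using TensorProduct.induction_on with
  | zero => simp
  | add u v hu hv => simp only [map_add, add_tmul, tmul_add, hu, hv]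
  | tmul y₁ y₂ =>
  induction w using TensorProduct.induction_on with
  | zero => simp
  | add u v hu hv => simp only [map_add, tmul_add, hu, hv]
  | tmul z₁ z₂ =>
  simp only [braidMid_tmul]
  have e1 : ∀ p : Y ⊗[K] X, map (TensorProduct.assoc K X Y Z).toLinearMap
      (TensorProduct.assoc K X Y Z).toLinearMap (braidMid (X ⊗[K] Y) Z (D.tensor E) F
      ((regroup (K := K) X Y X Y).symm (x₁ ⊗ₜ (p ⊗ₜ y₂)) ⊗ₜ (z₁ ⊗ₜ z₂))) =
      map (TensorProduct.mk K X _ x₁) .id (((TensorProduct.assoc K _ _ _).symm.toLinearMap ∘ₗ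
        map LinearMap.id ((TensorProduct.assoc K _ _ _).toLinearMap ∘ₗ
          map (braid D F) ((TensorProduct.mk K Y Z).flip z₂) ∘ₗ
            (TensorProduct.assoc K _ _ _).symm.toLinearMap))
        (TensorProduct.assoc K _ _ _ (p ⊗ₜ braid E F (y₂ ⊗ₜ z₁)))) := fun p => by
    induction p using TensorProduct.induction_on with
    | zero => simp
    | add u v hu hv => simp only [map_add, add_tmul, tmul_add, hu, hv]
    | tmul y₁ x₂ =>
    simp only [regroup_symm_tmul, braidMid_tmul, braid_tensor_left D E hF]
    generalize braid E F (y₂ ⊗ₜ z₁) = q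
    induction q using TensorProduct.induction_on with
    | zero => simp
    | add u v hu hv => simp only [map_add, add_tmul, tmul_add, hu, hv]
    | tmul z₁ y₂ =>
    simp only [assoc_symm_tmul, LinearMap.rTensor_tmul, assoc_tmul, LinearMap.comp_apply,
      map_tmul, LinearEquiv.coe_coe]
    generalize braid D F (x₂ ⊗ₜ z₁) = r
    induction r using TensorProduct.induction_on with
    | zero => simp
    | add u v hu hv => simp only [map_add, add_tmul, tmul_add, hu, hv]
    | tmul z₁ x₂ => simp
  rw [e1]
  generalize braid E F (y₂ ⊗ₜ z₁) = q
  induction q using TensorProduct.induction_on with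
  | zero => simp
  | add u v hu hv => simp only [map_add, add_tmul, tmul_add, hu, hv]
  | tmul z₁ y₂ =>
  simp only [regroup_symm_tmul, braidMid_tmul, braid_tensor_right hD E F]
  generalize braid D E (x₂ ⊗ₜ y₁) = p
  induction p using TensorProduct.induction_on with
  | zero => simp
  | add u v hu hv => simp only [map_add, add_tmul, tmul_add, hu, hv]
  | tmul y₁ x₂ =>
  simp only [assoc_symm_tmul, LinearMap.lTensor_tmul, assoc_tmul, LinearMap.comp_apply,
    map_tmul, LinearEquiv.coe_coe]
  generalize braid D F (x₂ ⊗ₜ z₁) = r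
  induction r using TensorProduct.induction_on with
  | zero => simp
  | add u v hu hv => simp only [map_add, add_tmul, tmul_add, hu, hv]
  | tmul z₁ x₂ => simp

end Braid

end YD

/-! ### Concatenation of tensors -/

section Split

variable {K V : Type*} [Field K] [AddCommMonoid V] [Module K V]

/-- The lengths are free variables tied by equations, so that no casts between tensor powers appear
in this or later statements. -/
theorem split_symm_assoc {i j k l m n : ℕ} (h₁ : i + j = m) (h₂ : m + k = n) (h₃ : j + k = l)
    (h₄ : i + l = n) (x : ⨂[K]^i V) (y : ⨂[K]^j V) (z : ⨂[K]^k V) :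
    (split K V h₂).symm ((split K V h₁).symm (x ⊗ₜ y) ⊗ₜ z) =
      (split K V h₄).symm (x ⊗ₜ (split K V h₃).symm (y ⊗ₜ z)) := by
  induction x using PiTensorProduct.induction_on with
  | add u v hu hv => simp only [map_add, add_tmul, hu, hv]
  | smul_tprod r x =>
  induction y using PiTensorProduct.induction_on with
  | add u v hu hv => simp only [map_add, add_tmul, tmul_add, hu, hv]
  | smul_tprod s y =>
  induction z using PiTensorProduct.induction_on with
  | add u v hu hv => simp only [map_add, tmul_add, hu, hv]
  | smul_tprod t z =>
  simp only [map_smul, ← smul_tmul', tmul_smul, split_symm_tprod]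
  congr 4
  subst h₁ h₃ h₂
  ext a
  simp only [Function.comp_apply]
  have := congrFun (Fin.append_assoc x y z) (Fin.cast rfl a)
  simp only [Function.comp_apply] at this
  exact this

theorem split_assoc {i j k l m n : ℕ} (h₁ : i + j = m) (h₂ : m + k = n) (h₃ : j + k = l)
    (h₄ : i + l = n) (t : ⨂[K]^n V) :
    TensorProduct.assoc K _ _ _ ((split K V h₁).toLinearMap.rTensor _ (split K V h₂ t)) =
      (split K V h₃).toLinearMap.lTensor _ (split K V h₄ t) := by
  obtain ⟨u, rfl⟩ := (split K V h₂).symm.surjective t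
  rw [LinearEquiv.apply_symm_apply]
  induction u using TensorProduct.induction_on with
  | zero => simp
  | add u v hu hv => simp only [map_add, hu, hv]
  | tmul u z =>
  obtain ⟨u, rfl⟩ := (split K V h₁).symm.surjective u
  induction u using TensorProduct.induction_on with
  | zero => simp
  | add u v hu hv => simp only [map_add, add_tmul, hu, hv]
  | tmul x y => simp [split_symm_assoc h₁ h₂ h₃ h₄]

variable (K V) in
/-- The canonical identification `V^{⊗ 0} = K`. -/
noncomputable def powZero : ⨂[K]^0 V ≃ₗ[K] K := PiTensorProduct.isEmptyEquiv (Fin 0)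

theorem split_symm_zero_left {n : ℕ} (h : 0 + n = n) (x : ⨂[K]^0 V) (y : ⨂[K]^n V) :
    (split K V h).symm (x ⊗ₜ y) = powZero K V x • y := by
  induction x using PiTensorProduct.induction_on with
  | add u v hu hv => simp only [map_add, add_tmul, add_smul, hu, hv]
  | smul_tprod r x =>
  induction y using PiTensorProduct.induction_on with
  | add u v hu hv => simp only [map_add, tmul_add, smul_add, hu, hv]
  | smul_tprod s y =>
  simp only [map_smul, ← smul_tmul', tmul_smul, split_symm_tprod, powZero,
    PiTensorProduct.isEmptyEquiv_apply_tprod, smul_eq_mul, mul_one]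
  rw [smul_comm]
  congr 3
  ext a
  rw [Subsingleton.elim x Fin.elim0, Fin.elim0_append]
  rfl

theorem split_symm_zero_right {n : ℕ} (h : n + 0 = n) (x : ⨂[K]^n V) (y : ⨂[K]^0 V) :
    (split K V h).symm (x ⊗ₜ y) = powZero K V y • x := by
  induction x using PiTensorProduct.induction_on with
  | add u v hu hv => simp only [map_add, add_tmul, smul_add, hu, hv]
  | smul_tprod r x =>
  induction y using PiTensorProduct.induction_on with
  | add u v hu hv => simp only [map_add, tmul_add, add_smul, hu, hv]
  | smul_tprod s y =>
  simp only [map_smul, ← smul_tmul', tmul_smul, split_symm_tprod, powZero,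
    PiTensorProduct.isEmptyEquiv_apply_tprod, smul_eq_mul, mul_one]
  congr 3
  ext a
  rw [Subsingleton.elim y Fin.elim0, Fin.append_elim0]
  rfl

theorem split_zero_left {n : ℕ} (h : 0 + n = n) (t : ⨂[K]^n V) :
    split K V h t = (powZero K V).symm 1 ⊗ₜ t := by
  rw [← LinearEquiv.eq_symm_apply, split_symm_zero_left]
  simp

theorem split_zero_right {n : ℕ} (h : n + 0 = n) (t : ⨂[K]^n V) :
    split K V h t = t ⊗ₜ (powZero K V).symm 1 := by
  rw [← LinearEquiv.eq_symm_apply, split_symm_zero_right]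
  simp

@[elab_as_elim]
theorem split_induction {i j n : ℕ} (h : i + j = n) {p : ⨂[K]^n V → Prop} (t : ⨂[K]^n V)
    (zero : p 0) (add : ∀ s t, p s → p t → p (s + t))
    (tmul : ∀ x y, p ((split K V h).symm (x ⊗ₜ y))) : p t := by
  obtain ⟨u, rfl⟩ := (split K V h).symm.surjective t
  induction u using TensorProduct.induction_on with
  | zero => simpa using zero
  | add u v hu hv => simpa using add _ _ hu hv
  | tmul x y => exact tmul x y

/-! ### Operators attached to words -/

variable {σ : V ⊗[K] V →ₗ[K] V ⊗[K] V}

/-- Replaces the truncated subtractions in `sigmaAt` by free lengths. -/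
theorem sigmaAt_split_symm {a b m n : ℕ} (h₁ : 2 + b = m) (h₂ : a + m = n) (x : ⨂[K]^a V)
    (s : ⨂[K]^2 V) (y : ⨂[K]^b V) :
    sigmaAt σ n a ((split K V h₂).symm (x ⊗ₜ (split K V h₁).symm (s ⊗ₜ y))) =
      (split K V h₂).symm (x ⊗ₜ (split K V h₁).symm (sigmaTwo σ s ⊗ₜ y)) := by
  obtain rfl : b = n - a - 2 := by omega
  obtain rfl : m = n - a := by omega
  rw [sigmaAt, dif_pos (by omega)]
  simp

theorem sigmaAt_split_symm_last {a n : ℕ} (h : a + 2 = n) (x : ⨂[K]^a V) (s : ⨂[K]^2 V) :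
    sigmaAt σ n a ((split K V h).symm (x ⊗ₜ s)) = (split K V h).symm (x ⊗ₜ sigmaTwo σ s) := by
  -- A trivial factor of length zero is inserted at the right end.
  have := sigmaAt_split_symm (σ := σ) (rfl : 2 + 0 = 2) h x s ((powZero K V).symm 1)
  simpa [split_symm_zero_right] using this

theorem sigmaAt_split_symm_left {a m k n : ℕ} (ha : a + 1 < m) (h : m + k = n) (x : ⨂[K]^m V)
    (z : ⨂[K]^k V) :
    sigmaAt σ n a ((split K V h).symm (x ⊗ₜ z)) = (split K V h).symm (sigmaAt σ m a x ⊗ₜ z) := by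
  induction x using split_induction (show a + (m - a) = m by omega) with
  | zero => simp
  | add u v hu hv => simp only [map_add, add_tmul, hu, hv]
  | tmul x y =>
  induction y using split_induction (show 2 + (m - a - 2) = m - a by omega) with
  | zero => simp
  | add u v hu hv => simp only [map_add, add_tmul, tmul_add, hu, hv]
  | tmul s y =>
  have e : ∀ s, (split K V h).symm ((split K V (show a + (m - a) = m by omega)).symm
      (x ⊗ₜ (split K V (show 2 + (m - a - 2) = m - a by omega)).symm (s ⊗ₜ y)) ⊗ₜ z) =
      (split K V (show a + (n - a) = n by omega)).symm (x ⊗ₜ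
        (split K V (show 2 + (n - a - 2) = n - a by omega)).symm (s ⊗ₜ
          (split K V (show m - a - 2 + k = n - a - 2 by omega)).symm (y ⊗ₜ z))) := fun s => by
    rw [split_symm_assoc _ _ (show m - a + k = n - a by omega) (show a + (n - a) = n by omega),
      split_symm_assoc]
  rw [e, sigmaAt_split_symm, sigmaAt_split_symm, e]

theorem sigmaAt_split_symm_right {a m k n : ℕ} (ha : a + 1 < m) (h : k + m = n) (z : ⨂[K]^k V)
    (x : ⨂[K]^m V) :
    sigmaAt σ n (k + a) ((split K V h).symm (z ⊗ₜ x)) =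
      (split K V h).symm (z ⊗ₜ sigmaAt σ m a x) := by
  induction x using split_induction (show a + (m - a) = m by omega) with
  | zero => simp
  | add u v hu hv => simp only [map_add, tmul_add, hu, hv]
  | tmul x y =>
  induction y using split_induction (show 2 + (m - a - 2) = m - a by omega) with
  | zero => simp
  | add u v hu hv => simp only [map_add, tmul_add, hu, hv]
  | tmul s y =>
  rw [sigmaAt_split_symm, ← split_symm_assoc (show k + a = k + a from rfl)
    (show k + a + (m - a) = n by omega), sigmaAt_split_symm, split_symm_assoc]

theorem wordOp_append (n : ℕ) (w w' : List ℕ) (t : ⨂[K]^n V) :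
    wordOp σ n (w ++ w') t = wordOp σ n w (wordOp σ n w' t) := by
  simp [wordOp]

theorem wordOp_nil (n : ℕ) (t : ⨂[K]^n V) : wordOp σ n [] t = t := by
  simp [wordOp]

theorem wordOp_cons (n a : ℕ) (w : List ℕ) (t : ⨂[K]^n V) :
    wordOp σ n (a :: w) t = sigmaAt σ n a (wordOp σ n w t) := by
  simp [wordOp]

theorem wordOp_split_symm_left {m k n : ℕ} (h : m + k = n) (w : List ℕ) (hw : ∀ a ∈ w, a + 1 < m)
    (x : ⨂[K]^m V) (z : ⨂[K]^k V) :
    wordOp σ n w ((split K V h).symm (x ⊗ₜ z)) = (split K V h).symm (wordOp σ m w x ⊗ₜ z) := by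
  induction w with
  | nil => simp [wordOp_nil]
  | cons a w ih =>
    rw [wordOp_cons, ih fun b hb => hw b (by simp [hb]), sigmaAt_split_symm_left (hw a (by simp)),
      wordOp_cons]

theorem wordOp_split_symm_right {m k n : ℕ} (h : k + m = n) (w : List ℕ) (hw : ∀ a ∈ w, a + 1 < m)
    (z : ⨂[K]^k V) (x : ⨂[K]^m V) :
    wordOp σ n (w.map fun a => k + a) ((split K V h).symm (z ⊗ₜ x)) =
      (split K V h).symm (z ⊗ₜ wordOp σ m w x) := by
  induction w with
  | nil => simp [wordOp_nil]
  | cons a w ih =>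
    rw [List.map_cons, wordOp_cons, ih fun b hb => hw b (by simp [hb]),
      sigmaAt_split_symm_right (hw a (by simp)), wordOp_cons]

/-- The letters stay inside the first `i + j` slots, so the word acts on a longer power without
touching the remaining factors. -/
theorem chiWord_lt (i j : ℕ) : ∀ a ∈ chiWord i j, a + 1 < i + j := by
  induction j with
  | zero => simp [chiWord]
  | succ j ih =>
    intro a ha
    rw [chiWord, List.mem_append] at ha
    rcases ha with ha | ha
    · obtain ⟨b, hb, rfl⟩ := List.mem_map.1 ha
      have := List.mem_range.1 hb
      omega
    · have := ih a ha
      omega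

end Split

/-! ### Tensor powers of a Yetter-Drinfeld module -/

section Pow

variable {K H V : Type*} [Field K] [Ring H] [HopfAlgebra K H] [AddCommMonoid V] [Module K V]

theorem isMorphism_powZero (D : ActCoact K H V) :
    IsMorphism (D.pow 0) ActCoact.unit (powZero K V).toLinearMap :=
  (isMorphism_transport ActCoact.unit (PiTensorProduct.isEmptyEquiv (Fin 0)).symm).symm

theorem isMorphism_pow_succ (D : ActCoact K H V) (n : ℕ) :
    IsMorphism (D.pow (n + 1)) (D.tensor (D.pow n)) ((split K V (n := n + 1) (i := 1) (j := n)
      (add_comm 1 n)).trans (TensorProduct.congr (powOne K V) (LinearEquiv.refl K _))).toLinearMap :=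
  (isMorphism_transport (D.tensor (D.pow n)) _).symm

/-- By the recursive definition `V^{⊗ 1}` carries the structure of `V ⊗ K`, so the identification
with `V` goes through the right unitor. -/
theorem isMorphism_powOne (D : ActCoact K H V) :
    IsMorphism (D.pow 1) D (powOne K V).toLinearMap := by
  have h := (isMorphism_rid D).comp
    ((IsMorphism.id.tensor (isMorphism_powZero D)).comp (isMorphism_pow_succ D 0))
  convert h using 1
  refine LinearMap.ext fun t => ?_
  induction t using split_induction (show 1 + 0 = 1 from rfl) with
  | zero => simp
  | add u v hu hv => simp only [map_add, hu, hv]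
  | tmul x y => simp [split_symm_zero_right, split_zero_right]

theorem isMorphism_split_one (D : ActCoact K H V) {n m : ℕ} (h : 1 + n = m) :
    IsMorphism (D.pow m) ((D.pow 1).tensor (D.pow n)) (split K V h).toLinearMap := by
  obtain rfl : m = n + 1 := by omega
  convert ((isMorphism_powOne D).symm.tensor .id).comp (isMorphism_pow_succ D n) using 1
  refine LinearMap.ext fun t => ?_
  induction t using split_induction h with
  | zero => simp
  | add u v hu hv => simp only [map_add, hu, hv]
  | tmul x y => simp

/-- The structure on tensor powers is defined by peeling off one factor on the left. Induction on
`i` with the associator shows that every other cut respects it as well. -/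
theorem isMorphism_split (D : ActCoact K H V) {i j n : ℕ} (h : i + j = n) :
    IsMorphism (D.pow n) ((D.pow i).tensor (D.pow j)) (split K V h).toLinearMap := by
  induction i generalizing n with
  | zero =>
    obtain rfl : j = n := by omega
    convert ((isMorphism_powZero D).symm.tensor .id).comp (isMorphism_lid (D.pow j)).symm using 1
    exact LinearMap.ext fun t => by simp [split_zero_left]
  | succ i ih =>
    obtain ⟨m, rfl⟩ : ∃ m, n = m + 1 := ⟨i + j, by omega⟩
    have h₁ : i + j = m := by omega
    have h₂ : 1 + m = m + 1 := by omega
    have h₃ : 1 + i = i + 1 := by omega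
    -- Cut off one factor, cut the rest at `i`, rebracket, and join the single factor to the first
    -- part.
    convert ((isMorphism_split_one D h₃).symm.tensor .id).comp ((isMorphism_assoc _ _ _).symm.comp
      ((IsMorphism.id.tensor (ih h₁)).comp (isMorphism_split_one D h₂))) using 1
    refine LinearMap.ext fun t => ?_
    have e := split_assoc h₃ h h₁ h₂ t
    rw [← LinearEquiv.eq_symm_apply] at e
    simp only [LinearMap.comp_apply, LinearEquiv.coe_coe]
    rw [← LinearMap.lTensor, ← e, ← LinearMap.rTensor, ← LinearMap.rTensor_comp_apply]
    simp

theorem IsYetterDrinfeld.pow {D : ActCoact K H V} (hD : IsYetterDrinfeld D) (n : ℕ) :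
    IsYetterDrinfeld (D.pow n) := by
  induction n with
  | zero => exact isYetterDrinfeld_unit.transport _
  | succ n ih => exact (hD.tensor ih).transport _

variable {D : ActCoact K H V}

/-- Naturality of the braiding along the identification of `V^{⊗ 1}` with `V`. -/
theorem sigmaTwo_split_symm (D : ActCoact K H V) (h : 1 + 1 = 2) (u : ⨂[K]^1 V ⊗[K] ⨂[K]^1 V) :
    sigmaTwo (naturalBraiding D) ((split K V h).symm u) =
      (split K V h).symm (braid (D.pow 1) (D.pow 1) u) := by
  have e := braid_map (isMorphism_powOne D) (isMorphism_powOne D) u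
  simp only [sigmaTwo, LinearMap.comp_apply, LinearEquiv.coe_coe, LinearEquiv.trans_apply,
    LinearEquiv.apply_symm_apply, naturalBraiding_eq_braid]
  rw [LinearEquiv.symm_apply_eq, LinearEquiv.trans_apply, LinearEquiv.apply_symm_apply]
  exact e

theorem braid_pow_zero_left (hD : IsYetterDrinfeld D) (n : ℕ) (x : ⨂[K]^0 V) (y : ⨂[K]^n V) :
    braid (D.pow 0) (D.pow n) (x ⊗ₜ y) = y ⊗ₜ x := by
  have e := braid_map (isMorphism_powZero D).symm (IsMorphism.id (D := D.pow n))
    (powZero K V x ⊗ₜ y)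
  simpa [braid_unit_left (hD.pow n)] using e

theorem braid_pow_zero_right (hD : IsYetterDrinfeld D) (n : ℕ) (x : ⨂[K]^n V) (y : ⨂[K]^0 V) :
    braid (D.pow n) (D.pow 0) (x ⊗ₜ y) = y ⊗ₜ x := by
  have e := braid_map (IsMorphism.id (D := D.pow n)) (isMorphism_powZero D).symm
    (x ⊗ₜ powZero K V y)
  simpa [braid_unit_right (hD.pow n)] using e

theorem braid_split_symm_left (hD : IsYetterDrinfeld D) {i j m k : ℕ} (h : i + j = m)
    (x : ⨂[K]^i V) (y : ⨂[K]^j V) (z : ⨂[K]^k V) :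
    braid (D.pow m) (D.pow k) ((split K V h).symm (x ⊗ₜ y) ⊗ₜ z) =
      (split K V h).symm.toLinearMap.lTensor _ (TensorProduct.assoc K _ _ _
      ((braid (D.pow i) (D.pow k)).rTensor _ ((TensorProduct.assoc K _ _ _).symm
        (x ⊗ₜ braid (D.pow j) (D.pow k) (y ⊗ₜ z))))) := by
  rw [← braid_tensor_left _ _ (hD.pow k)]
  exact braid_map (isMorphism_split D h).symm (IsMorphism.id (D := D.pow k)) ((x ⊗ₜ y) ⊗ₜ z)

theorem braid_split_symm_right (hD : IsYetterDrinfeld D) {i j m k : ℕ} (h : i + j = m)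
    (z : ⨂[K]^k V) (x : ⨂[K]^i V) (y : ⨂[K]^j V) :
    braid (D.pow k) (D.pow m) (z ⊗ₜ (split K V h).symm (x ⊗ₜ y)) =
      (split K V h).symm.toLinearMap.rTensor _ ((TensorProduct.assoc K _ _ _).symm
      ((braid (D.pow k) (D.pow j)).lTensor _ (TensorProduct.assoc K _ _ _
        (braid (D.pow k) (D.pow i) (z ⊗ₜ x) ⊗ₜ y)))) := by
  rw [← braid_tensor_right (hD.pow k)]
  exact braid_map (IsMorphism.id (D := D.pow k)) (isMorphism_split D h).symm (z ⊗ₜ (x ⊗ₜ y))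

/-- The last letter of the word acts first and crosses `v` with the last factor of `x`; the shorter
word moves `v` past the remaining ones. The hexagon in the left variable assembles the crossings. -/
theorem wordOp_range (hD : IsYetterDrinfeld D) {i n : ℕ} (h : i + 1 = n) (h' : 1 + i = n)
    (x : ⨂[K]^i V) (v : ⨂[K]^1 V) :
    wordOp (naturalBraiding D) n (List.range i) ((split K V h).symm (x ⊗ₜ v)) =
      (split K V h').symm (braid (D.pow i) (D.pow 1) (x ⊗ₜ v)) := by
  induction i generalizing n v with
  | zero =>
    subst h
    rw [List.range_zero, wordOp_nil, braid_pow_zero_left hD, split_symm_zero_left,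
      split_symm_zero_right]
  | succ i ih =>
    rw [List.range_succ, wordOp_append, wordOp_cons, wordOp_nil]
    induction x using split_induction (rfl : i + 1 = i + 1) with
    | zero => simp
    | add u v hu hv => simp only [map_add, add_tmul, hu, hv]
    | tmul x u =>
    rw [split_symm_assoc _ _ (rfl : 1 + 1 = 2) (show i + 2 = n by omega), sigmaAt_split_symm_last,
      sigmaTwo_split_symm, braid_split_symm_left hD]
    generalize braid (D.pow 1) (D.pow 1) (u ⊗ₜ v) = w
    induction w using TensorProduct.induction_on with
    | zero => simp
    | add u v hu hv => simp only [map_add, tmul_add, hu, hv]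
    | tmul v u =>
    rw [← split_symm_assoc (rfl : i + 1 = i + 1) h, wordOp_split_symm_left _ _
      (fun a ha => by have := List.mem_range.1 ha; omega), ih rfl (by omega)]
    rw [assoc_symm_tmul, LinearMap.rTensor_tmul]
    generalize braid (D.pow i) (D.pow 1) (x ⊗ₜ v) = w
    induction w using TensorProduct.induction_on with
    | zero => simp
    | add u v hu hv => simp only [map_add, add_tmul, hu, hv]
    | tmul v x =>
    rw [assoc_tmul, LinearMap.lTensor_tmul, LinearEquiv.coe_coe, ← split_symm_assoc]

/-- The tail of the word moves `x` past the first `j` factors and its head moves `x` past the last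
one; the hexagon in the right variable combines them. -/
theorem wordOp_chiWord (hD : IsYetterDrinfeld D) {i j n : ℕ} (h : i + j = n) (h' : j + i = n)
    (x : ⨂[K]^i V) (y : ⨂[K]^j V) :
    wordOp (naturalBraiding D) n (chiWord i j) ((split K V h).symm (x ⊗ₜ y)) =
      (split K V h').symm (braid (D.pow i) (D.pow j) (x ⊗ₜ y)) := by
  induction j generalizing n with
  | zero =>
    subst h
    rw [chiWord, wordOp_nil, braid_pow_zero_right hD, split_symm_zero_right, split_symm_zero_left]
  | succ j ih =>
    rw [chiWord, wordOp_append]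
    induction y using split_induction (rfl : j + 1 = j + 1) with
    | zero => simp
    | add u v hu hv => simp only [map_add, tmul_add, hu, hv]
    | tmul y v =>
    rw [← split_symm_assoc rfl (show i + j + 1 = n by omega), wordOp_split_symm_left _ _
      (chiWord_lt i j), ih rfl (by omega), braid_split_symm_right hD]
    generalize braid (D.pow i) (D.pow j) (x ⊗ₜ y) = w
    induction w using TensorProduct.induction_on with
    | zero => simp
    | add u v hu hv => simp only [map_add, add_tmul, hu, hv]
    | tmul y x =>
    rw [split_symm_assoc _ _ (rfl : i + 1 = i + 1) (show j + (i + 1) = n by omega),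
      wordOp_split_symm_right _ _ (fun a ha => by have := List.mem_range.1 ha; omega),
      wordOp_range hD _ (by omega)]
    rw [assoc_tmul, LinearMap.lTensor_tmul]
    generalize braid (D.pow i) (D.pow 1) (x ⊗ₜ v) = w
    induction w using TensorProduct.induction_on with
    | zero => simp
    | add u v hu hv => simp only [map_add, tmul_add, hu, hv]
    | tmul v x =>
    rw [assoc_symm_tmul, LinearMap.rTensor_tmul, LinearEquiv.coe_coe, split_symm_assoc]

/-- The bridge from words in the `σ_a` to the category: from here on only naturality, the hexagons
and the unit laws of the braiding are used. -/
theorem betaComp_eq_braid (hD : IsYetterDrinfeld D) (i j : ℕ) :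
    betaComp (naturalBraiding D) i j = braid (D.pow i) (D.pow j) := by
  refine TensorProduct.ext' fun x y => ?_
  simp [betaComp, wordOp_chiWord hD rfl (add_comm j i)]

end Pow

/-! ### Jointly injective families -/

section JointlyInjective

variable {K : Type*} [Field K]

/-- A family of maps which separates points. -/
def JointlyInjective {M ι : Type*} {N : ι → Type*} (f : ∀ i, M → N i) : Prop :=
  ∀ x y, (∀ i, f i x = f i y) → x = y

/-- A basis of `B` identifies `B ⊗ M` with finitely supported families in `M`, on which each `f i`
acts coordinatewise. This makes it possible to compare elements of tensor powers of `T(V)` degree by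
degree. -/
theorem JointlyInjective.lTensor {M ι : Type*} [AddCommMonoid M] [Module K M] {N : ι → Type*}
    [∀ i, AddCommMonoid (N i)] [∀ i, Module K (N i)] {f : ∀ i, M →ₗ[K] N i}
    (hf : JointlyInjective fun i => f i) (B : Type*) [AddCommMonoid B] [Module K B] :
    JointlyInjective fun i => (f i).lTensor B := by
  classical
  -- Bases need additive inverses, which multiplication by the scalar `-1` supplies.
  let _ : AddCommGroup B := Module.addCommMonoidToAddCommGroup K
  intro u w h
  let b := Module.Basis.ofVectorSpace K B
  apply (TensorProduct.equivFinsuppOfBasisLeft (N := M) b).injective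
  ext k
  refine hf _ _ fun i => ?_
  have e : ∀ u, f i (TensorProduct.equivFinsuppOfBasisLeft b u k) =
      TensorProduct.equivFinsuppOfBasisLeft b ((f i).lTensor B u) k := fun u => by
    induction u using TensorProduct.induction_on with
    | zero => simp
    | add u v hu hv => simp only [map_add, Finsupp.add_apply, hu, hv]
    | tmul x y => simp
  exact (e u).trans ((congrArg (fun z => TensorProduct.equivFinsuppOfBasisLeft b z k) (h i)).trans
    (e w).symm)

theorem JointlyInjective.rTensor {M ι : Type*} [AddCommMonoid M] [Module K M] {N : ι → Type*}
    [∀ i, AddCommMonoid (N i)] [∀ i, Module K (N i)] {f : ∀ i, M →ₗ[K] N i}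
    (hf : JointlyInjective fun i => f i) (B : Type*) [AddCommMonoid B] [Module K B] :
    JointlyInjective fun i => (f i).rTensor B := by
  intro u w h
  apply (TensorProduct.comm K M B).injective
  refine hf.lTensor B _ _ fun i => ?_
  have e : ∀ u, (f i).lTensor B (TensorProduct.comm K M B u) =
      TensorProduct.comm K (N i) B ((f i).rTensor B u) := fun u => by
    induction u using TensorProduct.induction_on with
    | zero => simp
    | add u v hu hv => simp only [map_add, hu, hv]
    | tmul x y => simp
  exact (e u).trans ((congrArg _ (h i)).trans (e w).symm)

theorem JointlyInjective.tensor {M M' ι κ : Type*} [AddCommMonoid M] [Module K M]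
    [AddCommMonoid M'] [Module K M'] {N : ι → Type*} {N' : κ → Type*}
    [∀ i, AddCommMonoid (N i)] [∀ i, Module K (N i)] [∀ i, AddCommMonoid (N' i)]
    [∀ i, Module K (N' i)] {f : ∀ i, M →ₗ[K] N i} {g : ∀ i, M' →ₗ[K] N' i}
    (hf : JointlyInjective fun i => f i) (hg : JointlyInjective fun i => g i) :
    JointlyInjective fun p : ι × κ => map (f p.1) (g p.2) := by
  refine fun u w h => hf.rTensor M' _ _ fun i => hg.lTensor (N i) _ _ fun j => ?_
  simpa [← LinearMap.comp_apply, LinearMap.lTensor_comp_rTensor] using h (i, j)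

end JointlyInjective

/-! ### The coalgebra `T(V)` -/

section TensorSpace

variable {K V : Type*} [Field K] [AddCommMonoid V] [Module K V]

variable (K V) in
/-- The projection of `T(V)` onto `V^{⊗ n}`. -/
noncomputable abbrev proj (n : ℕ) : TensorSpace K V →ₗ[K] ⨂[K]^n V :=
  DirectSum.component K ℕ (fun n => ⨂[K]^n V) n

theorem jointlyInjective_proj : JointlyInjective fun n => proj K V n :=
  fun _ _ h => DFinsupp.ext h

theorem proj_incl (n : ℕ) (x : ⨂[K]^n V) : proj K V n (incl K V n x) = x :=
  DirectSum.component.lof_self ..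

theorem proj_incl_of_ne {m n : ℕ} (h : m ≠ n) (x : ⨂[K]^m V) : proj K V n (incl K V m x) = 0 := by
  rw [proj, DirectSum.component.of, dif_neg h]

@[elab_as_elim]
theorem tensorSpace_induction {p : TensorSpace K V → Prop} (t : TensorSpace K V) (zero : p 0)
    (add : ∀ s t, p s → p t → p (s + t)) (incl : ∀ n x, p (incl K V n x)) : p t :=
  DirectSum.induction_on t zero incl add

/-- This describes deconcatenation by its bihomogeneous components; the coalgebra laws are derived
from it rather than from the sum over cuts. -/
theorem map_proj_deconcat {a b n : ℕ} (h : a + b = n) (t : TensorSpace K V) :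
    map (proj K V a) (proj K V b) (deconcat K V t) = split K V h (proj K V n t) := by
  have key : ∀ (i j : ℕ) (u : ⨂[K]^i V ⊗[K] ⨂[K]^j V), ¬ (i = a ∧ j = b) →
      map (proj K V a) (proj K V b) (incl₂ K V i j u) = 0 := fun i j u hij => by
    induction u using TensorProduct.induction_on with
    | zero => simp
    | add u v hu hv => simp only [map_add, hu, hv, add_zero]
    | tmul x y =>
      rw [incl₂, map_tmul, map_tmul]
      by_cases hi : i = a
      · rw [proj_incl_of_ne (fun hj => hij ⟨hi, hj⟩), tmul_zero]
      · rw [proj_incl_of_ne hi, zero_tmul]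
  have key' : ∀ (i j : ℕ) (u : ⨂[K]^i V ⊗[K] ⨂[K]^j V),
      map (proj K V i) (proj K V j) (incl₂ K V i j u) = u := fun i j u => by
    induction u using TensorProduct.induction_on with
    | zero => simp
    | add u v hu hv => simp only [map_add, hu, hv]
    | tmul x y => rw [incl₂, map_tmul, map_tmul, proj_incl, proj_incl]
  induction t using tensorSpace_induction with
  | zero => simp
  | add s t hs ht => simp only [map_add, hs, ht]
  | incl m x =>
    simp only [deconcat, DirectSum.toModule_lof, LinearMap.sum_apply, map_sum,
      LinearMap.comp_apply, LinearEquiv.coe_coe]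
    by_cases hm : m = n
    · subst hm
      obtain rfl : b = m - a := by omega
      rw [Finset.sum_eq_single (⟨a, by omega⟩ : Fin (m + 1)), key', proj_incl]
      · intro i _ hi
        exact key _ _ _ fun h' => hi (Fin.ext h'.1)
      · simp
    · rw [proj_incl_of_ne hm, map_zero]
      exact Finset.sum_eq_zero fun i _ => key _ _ _ fun h' => hm (by have := i.2; omega)

/-- In tridegree `(a, b, c)` both sides cut the component of degree `a + b + c` at the same two
places. -/
theorem deconcat_coassoc :
    (TensorProduct.assoc K _ _ _).toLinearMap ∘ₗ (deconcat K V).rTensor _ ∘ₗ deconcat K V =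
      (deconcat K V).lTensor _ ∘ₗ deconcat K V := by
  refine LinearMap.ext fun t => jointlyInjective_proj.tensor (jointlyInjective_proj.tensor
    jointlyInjective_proj) _ _ ?_
  rintro ⟨a, b, c⟩
  have e₁ : ∀ u : TensorSpace K V ⊗[K] TensorSpace K V, map (proj K V a) (map (proj K V b)
      (proj K V c)) (TensorProduct.assoc K _ _ _ ((deconcat K V).rTensor _ u)) =
      TensorProduct.assoc K _ _ _ ((split K V rfl).toLinearMap.rTensor _
        (map (proj K V (a + b)) (proj K V c) u)) := fun u => by
    induction u using TensorProduct.induction_on with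
    | zero => simp
    | add u v hu hv => simp only [map_add, hu, hv]
    | tmul x y =>
      simp only [LinearMap.rTensor_tmul, map_tmul, LinearEquiv.coe_coe,
        ← map_proj_deconcat (rfl : a + b = a + b)]
      generalize deconcat K V x = u
      induction u using TensorProduct.induction_on with
      | zero => simp
      | add u v hu hv => simp only [map_add, add_tmul, hu, hv]
      | tmul x y => simp only [assoc_tmul, map_tmul]
  have e₂ : ∀ u : TensorSpace K V ⊗[K] TensorSpace K V, map (proj K V a) (map (proj K V b)
      (proj K V c)) ((deconcat K V).lTensor _ u) =
      (split K V rfl).toLinearMap.lTensor _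
        (map (proj K V a) (proj K V (b + c)) u) := fun u => by
    induction u using TensorProduct.induction_on with
    | zero => simp
    | add u v hu hv => simp only [map_add, hu, hv]
    | tmul x y =>
      simp only [LinearMap.lTensor_tmul, map_tmul, LinearEquiv.coe_coe,
        map_proj_deconcat (rfl : b + c = b + c)]
  simp only [LinearMap.comp_apply, LinearEquiv.coe_coe]
  rw [e₁, e₂, map_proj_deconcat rfl, map_proj_deconcat (show a + (b + c) = a + b + c by omega),
    split_assoc]

theorem counit_eq (t : TensorSpace K V) : counit K V t = powZero K V (proj K V 0 t) := rfl

theorem counit_deconcat_left (t : TensorSpace K V) :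
    TensorProduct.lid K _ ((counit K V).rTensor _ (deconcat K V t)) = t := by
  refine jointlyInjective_proj _ _ fun n => ?_
  beta_reduce
  have e : ∀ u : TensorSpace K V ⊗[K] TensorSpace K V, proj K V n (TensorProduct.lid K _
      ((counit K V).rTensor _ u)) = (split K V (zero_add n)).symm (map (proj K V 0) (proj K V n) u) :=
    fun u => by
      induction u using TensorProduct.induction_on with
      | zero => simp
      | add u v hu hv => simp only [map_add, hu, hv]
      | tmul x y =>
        rw [LinearMap.rTensor_tmul, lid_tmul, map_smul, map_tmul, split_symm_zero_left, counit_eq]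
  rw [e, map_proj_deconcat (zero_add n), LinearEquiv.symm_apply_apply]

theorem counit_deconcat_right (t : TensorSpace K V) :
    TensorProduct.rid K _ ((counit K V).lTensor _ (deconcat K V t)) = t := by
  refine jointlyInjective_proj _ _ fun n => ?_
  beta_reduce
  have e : ∀ u : TensorSpace K V ⊗[K] TensorSpace K V, proj K V n (TensorProduct.rid K _
      ((counit K V).lTensor _ u)) = (split K V (add_zero n)).symm (map (proj K V n) (proj K V 0) u) :=
    fun u => by
      induction u using TensorProduct.induction_on with
      | zero => simp
      | add u v hu hv => simp only [map_add, hu, hv]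
      | tmul x y =>
        rw [LinearMap.lTensor_tmul, rid_tmul, map_smul, map_tmul, split_symm_zero_right, counit_eq]
  rw [e, map_proj_deconcat (add_zero n), LinearEquiv.symm_apply_apply]

/-- A coalgebra map to `T(V)` is determined by its components in degrees `0` and `1`. -/
theorem coalgebraMap_ext {C : Type*} [AddCommMonoid C] [Module K C] {Δ : C →ₗ[K] C ⊗[K] C}
    {f g : C →ₗ[K] TensorSpace K V} (hf : deconcat K V ∘ₗ f = map f f ∘ₗ Δ)
    (hg : deconcat K V ∘ₗ g = map g g ∘ₗ Δ) (h₀ : proj K V 0 ∘ₗ f = proj K V 0 ∘ₗ g)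
    (h₁ : proj K V 1 ∘ₗ f = proj K V 1 ∘ₗ g) : f = g := by
  -- Compare the components of bidegree `(n, 1)` of the coalgebra-map identity. Nothing is needed
  -- about `Δ` itself.
  have key : ∀ {f : C →ₗ[K] TensorSpace K V}, deconcat K V ∘ₗ f = map f f ∘ₗ Δ → ∀ n,
      proj K V (n + 1) ∘ₗ f = (split K V rfl).symm.toLinearMap ∘ₗ
        map (proj K V n ∘ₗ f) (proj K V 1 ∘ₗ f) ∘ₗ Δ := fun {f} hf n => by
    rw [map_comp, LinearMap.comp_assoc, ← hf]
    exact LinearMap.ext fun c => by simp [map_proj_deconcat rfl]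
  have h : ∀ n, proj K V n ∘ₗ f = proj K V n ∘ₗ g := fun n => by
    induction n with
    | zero => exact h₀
    | succ n ih => rw [key hf, key hg, ih, h₁]
  exact LinearMap.ext fun c => jointlyInjective_proj _ _ fun n => LinearMap.congr_fun (h n) c

theorem incl₂_ext {X : Type*} [AddCommMonoid X] [Module K X]
    {f g : TensorSpace K V ⊗[K] TensorSpace K V →ₗ[K] X}
    (h : ∀ i j, f ∘ₗ incl₂ K V i j = g ∘ₗ incl₂ K V i j) : f = g := by
  refine TensorProduct.ext' fun x y => ?_
  induction x using tensorSpace_induction with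
  | zero => simp
  | add s t hs ht => simp only [map_add, add_tmul, hs, ht]
  | incl i x =>
  induction y using tensorSpace_induction with
  | zero => simp
  | add s t hs ht => simp only [map_add, tmul_add, hs, ht]
  | incl j y => exact LinearMap.congr_fun (h i j) (x ⊗ₜ y)

end TensorSpace

/-! ### `T(V)` as a coalgebra of Yetter-Drinfeld modules, and its braided square -/

section YetterDrinfeld

variable {K H V : Type*} [Field K] [Ring H] [HopfAlgebra K H] [AddCommMonoid V] [Module K V]
  {D : ActCoact K H V}

theorem isMorphism_incl (D : ActCoact K H V) (n : ℕ) :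
    IsMorphism (D.pow n) D.tensorSpace (incl K V n) := isMorphism_lof D.pow n

theorem IsYetterDrinfeld.tensorSpace (hD : IsYetterDrinfeld D) : IsYetterDrinfeld D.tensorSpace :=
  .directSum hD.pow

/-- A map on a space which is spanned by the images of morphisms is a morphism if its composites
with them are. -/
theorem IsMorphism.of_span {X Y ι : Type*} [AddCommMonoid X] [Module K X] [AddCommMonoid Y]
    [Module K Y] {E : ActCoact K H X} {F : ActCoact K H Y} {A : ι → Type*}
    [∀ i, AddCommMonoid (A i)] [∀ i, Module K (A i)] {D : ∀ i, ActCoact K H (A i)}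
    {f : ∀ i, A i →ₗ[K] X} {g : X →ₗ[K] Y} (hf : ∀ i, IsMorphism (D i) E (f i))
    (hg : ∀ i, IsMorphism (D i) F (g ∘ₗ f i))
    (hspan : ∀ p : X → Prop, (zero : p 0) → (add : ∀ a b, p a → p b → p (a + b)) →
      (map : ∀ i x, p (f i x)) → ∀ y, p y) : IsMorphism E F g := by
  refine .of_apply (fun h x => ?_) fun x => ?_
  · induction x using hspan with
    | zero => simp
    | add u v hu hv => simp only [map_add, tmul_add, hu, hv]
    | map i x =>
      have h₁ := (hf i).apply_act (h ⊗ₜ x)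
      have h₂ := (hg i).apply_act (h ⊗ₜ x)
      simp only [LinearMap.lTensor_tmul, LinearMap.comp_apply] at h₁ h₂
      rw [← h₁, h₂]
  · induction x using hspan with
    | zero => simp
    | add u v hu hv => simp only [map_add, hu, hv]
    | map i x =>
      have h₂ := (hg i).coact_apply x
      rw [LinearMap.lTensor_comp_apply, ← (hf i).coact_apply] at h₂
      exact h₂

theorem isMorphism_of_incl {Y : Type*} [AddCommMonoid Y] [Module K Y] {E : ActCoact K H Y}
    {g : TensorSpace K V →ₗ[K] Y} (h : ∀ n, IsMorphism (D.pow n) E (g ∘ₗ incl K V n)) :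
    IsMorphism D.tensorSpace E g :=
  .of_span (isMorphism_incl D) h fun _ h0 hadd h y => tensorSpace_induction y h0 hadd h

theorem isMorphism_of_incl₂ {Y : Type*} [AddCommMonoid Y] [Module K Y] {E : ActCoact K H Y}
    {g : TensorSpace K V ⊗[K] TensorSpace K V →ₗ[K] Y}
    (h : ∀ i j, IsMorphism ((D.pow i).tensor (D.pow j)) E (g ∘ₗ incl₂ K V i j)) :
    IsMorphism (D.tensorSpace.tensor D.tensorSpace) E g := by
  refine .of_span (ι := ℕ × ℕ) (fun i => (isMorphism_incl D i.1).tensor (isMorphism_incl D i.2))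
    (fun i => h i.1 i.2) fun p h0 hadd h u => ?_
  induction u using TensorProduct.induction_on with
  | zero => exact h0
  | add u v hu hv => exact hadd u v hu hv
  | tmul x y =>
  induction x using tensorSpace_induction with
  | zero => simpa using h0
  | add s t hs ht => simpa only [add_tmul] using hadd _ _ hs ht
  | incl i x =>
  induction y using tensorSpace_induction with
  | zero => simpa using h0
  | add s t hs ht => simpa only [tmul_add] using hadd _ _ hs ht
  | incl j y => exact h (i, j) (x ⊗ₜ y)

theorem isMorphism_deconcat (D : ActCoact K H V) :
    IsMorphism D.tensorSpace (D.tensorSpace.tensor D.tensorSpace) (deconcat K V) := by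
  refine isMorphism_of_incl fun n => ?_
  have e : deconcat K V ∘ₗ incl K V n = ∑ i : Fin (n + 1), incl₂ K V i (n - i) ∘ₗ
      (split K V (i := (i : ℕ)) (j := n - i) (by omega)).toLinearMap :=
    LinearMap.ext fun x => by simp [deconcat]
  rw [e]
  exact .sum _ fun i _ => ((isMorphism_incl D _).tensor (isMorphism_incl D _)).comp
    (isMorphism_split D _)

theorem isMorphism_counit (D : ActCoact K H V) :
    IsMorphism D.tensorSpace ActCoact.unit (counit K V) := by
  refine isMorphism_of_incl fun n => ?_
  cases n with
  | zero =>
    convert isMorphism_powZero D using 1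
    exact LinearMap.ext fun x => by rw [LinearMap.comp_apply, counit_eq, proj_incl]; rfl
  | succ n =>
    convert IsMorphism.zero (D := D.pow (n + 1)) using 1
    refine LinearMap.ext fun x => ?_
    rw [LinearMap.comp_apply, counit_eq, proj_incl_of_ne (by omega), map_zero]
    rfl

theorem isMorphism_unitMap (D : ActCoact K H V) :
    IsMorphism ActCoact.unit D.tensorSpace (unitMap K V) :=
  (isMorphism_incl D 0).comp (isMorphism_powZero D).symm

/-- The components agree by `betaComp_eq_braid`, and the braiding of `T(V)` is natural along the
inclusions of the homogeneous parts. -/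
theorem beta_eq_braid (hD : IsYetterDrinfeld D) :
    beta (naturalBraiding D) = braid D.tensorSpace D.tensorSpace := by
  refine incl₂_ext fun i j => ?_
  rw [beta, ofComponents_incl₂, betaComp_eq_braid hD]
  exact LinearMap.ext fun u => (braid_map (isMorphism_incl D i) (isMorphism_incl D j) u).symm

theorem comulBeta_eq_tensorComul (hD : IsYetterDrinfeld D) :
    comulBeta (naturalBraiding D) =
      tensorComul D.tensorSpace D.tensorSpace (deconcat K V) (deconcat K V) := by
  rw [comulBeta, beta_eq_braid hD]
  rfl

theorem comulBeta_coassoc (hD : IsYetterDrinfeld D) :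
    (TensorProduct.assoc K _ _ _).toLinearMap ∘ₗ (comulBeta (naturalBraiding D)).rTensor _ ∘ₗ
      comulBeta (naturalBraiding D) =
    (comulBeta (naturalBraiding D)).lTensor _ ∘ₗ comulBeta (naturalBraiding D) := by
  rw [comulBeta_eq_tensorComul hD]
  exact tensorComul_coassoc hD.tensorSpace hD.tensorSpace (isMorphism_deconcat D)
    (isMorphism_deconcat D) deconcat_coassoc deconcat_coassoc

theorem isMorphism_comulBeta (hD : IsYetterDrinfeld D) :
    IsMorphism (D.tensorSpace.tensor D.tensorSpace)
      ((D.tensorSpace.tensor D.tensorSpace).tensor (D.tensorSpace.tensor D.tensorSpace))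
      (comulBeta (naturalBraiding D)) := by
  rw [comulBeta_eq_tensorComul hD]
  exact isMorphism_tensorComul hD.tensorSpace hD.tensorSpace (isMorphism_deconcat D)
    (isMorphism_deconcat D)

/-! ### Counit laws for `△_β` -/

variable (K V) in
/-- The counit `ε ⊗ ε` with values in `K`. -/
noncomputable def counitMul : TensorSpace K V ⊗[K] TensorSpace K V →ₗ[K] K :=
  (TensorProduct.lid K K).toLinearMap ∘ₗ map (counit K V) (counit K V)

/-- The counit is a morphism, so it can be applied before the crossing. What remains is a crossing
with the ground field, which is the flip, and the counit law of deconcatenation in each variable. -/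
theorem counitMul_comulBeta_left (hD : IsYetterDrinfeld D)
    (u : TensorSpace K V ⊗[K] TensorSpace K V) :
    (counitMul K V).rTensor _ (comulBeta (naturalBraiding D) u) = 1 ⊗ₜ u := by
  have h := fun u => braidMid_map (counit K V) (.id (R := K) (M := TensorSpace K V))
    (IsMorphism.id (D := D.tensorSpace)) (isMorphism_counit D) u
  have e : (counitMul K V).rTensor (TensorSpace K V ⊗[K] TensorSpace K V) =
      (TensorProduct.lid K K).toLinearMap.rTensor _ ∘ₗ map (map (counit K V) (counit K V))
        (map .id .id) := by
    rw [counitMul, LinearMap.rTensor_comp, map_id]; rfl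
  rw [e, LinearMap.comp_apply, comulBeta_eq_tensorComul hD, tensorComul, LinearMap.comp_apply, ← h]
  clear h
  induction u using TensorProduct.induction_on with
  | zero => simp
  | add u v hu hv => simp only [map_add, tmul_add, hu, hv]
  | tmul x y =>
  conv_rhs => rw [← counit_deconcat_left x, ← counit_deconcat_left y]
  rw [map_tmul]
  generalize deconcat K V x = u
  generalize deconcat K V y = v
  induction u using TensorProduct.induction_on with
  | zero => simp
  | add u v hu hv => simp only [map_add, add_tmul, tmul_add, hu, hv]
  | tmul x₁ x₂ =>
  induction v using TensorProduct.induction_on with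
  | zero => simp
  | add u v hu hv => simp only [map_add, tmul_add, hu, hv]
  | tmul y₁ y₂ =>
  have hb := braid_unit_right hD.tensorSpace x₂ (counit K V y₁)
  simp only [map_tmul, LinearMap.id_apply, braidMid_tmul, hb, regroup_symm_tmul,
    LinearMap.rTensor_tmul, LinearEquiv.coe_coe, lid_tmul, smul_eq_mul]
  rw [smul_tmul_smul, tmul_smul, smul_tmul', smul_eq_mul, mul_one]

theorem counitMul_comulBeta_right (hD : IsYetterDrinfeld D)
    (u : TensorSpace K V ⊗[K] TensorSpace K V) :
    (counitMul K V).lTensor _ (comulBeta (naturalBraiding D) u) = u ⊗ₜ 1 := by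
  have h := fun u => braidMid_map (.id (R := K) (M := TensorSpace K V)) (counit K V)
    (isMorphism_counit D) (IsMorphism.id (D := D.tensorSpace)) u
  have e : (counitMul K V).lTensor (TensorSpace K V ⊗[K] TensorSpace K V) =
      (TensorProduct.lid K K).toLinearMap.lTensor _ ∘ₗ map (map .id .id)
        (map (counit K V) (counit K V)) := by
    rw [counitMul, LinearMap.lTensor_comp, map_id]; rfl
  rw [e, LinearMap.comp_apply, comulBeta_eq_tensorComul hD, tensorComul, LinearMap.comp_apply, ← h]
  clear h
  induction u using TensorProduct.induction_on with
  | zero => simp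
  | add u v hu hv => simp only [map_add, add_tmul, hu, hv]
  | tmul x y =>
  conv_rhs => rw [← counit_deconcat_right x, ← counit_deconcat_right y]
  rw [map_tmul]
  generalize deconcat K V x = u
  generalize deconcat K V y = v
  induction u using TensorProduct.induction_on with
  | zero => simp
  | add u v hu hv => simp only [map_add, add_tmul, hu, hv]
  | tmul x₁ x₂ =>
  induction v using TensorProduct.induction_on with
  | zero => simp
  | add u v hu hv => simp only [map_add, add_tmul, tmul_add, hu, hv]
  | tmul y₁ y₂ =>
  have hb := braid_unit_left hD.tensorSpace (counit K V x₂) y₁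
  simp only [map_tmul, LinearMap.id_apply, braidMid_tmul, hb, regroup_symm_tmul,
    LinearMap.lTensor_tmul, LinearEquiv.coe_coe, lid_tmul, rid_tmul, smul_eq_mul]
  rw [smul_tmul_smul, ← smul_tmul', ← tmul_smul, smul_eq_mul, mul_one]

end YetterDrinfeld

/-! ### The product `∗` -/

section OpPow

variable {K V : Type*} [Field K] [AddCommMonoid V] [Module K V]
  (σ : V ⊗[K] V →ₗ[K] V ⊗[K] V) (M : Operations K V)

theorem map_powOne_symm {C : Type*} [AddCommMonoid C] [Module K C] (f : C →ₗ[K] V) (c : C) :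
    PiTensorProduct.map (fun _ : Fin 1 => f) ((powOne K C).symm c) = (powOne K V).symm (f c) := by
  simp [powOne]

theorem opPow_zero : opPow σ M 0 = (powOne K V).symm.toLinearMap ∘ₗ ofComponents M :=
  LinearMap.ext fun _ => map_powOne_symm _ _

theorem opPow_succ (n : ℕ) : opPow σ M (n + 1) =
    (split K V (rfl : n + 1 + 1 = n + 1 + 1)).symm.toLinearMap ∘ₗ
      map (opPow σ M n) (opPow σ M 0) ∘ₗ comulBeta σ := by
  refine LinearMap.ext fun u => ?_
  simp only [opPow, iterComul, LinearMap.comp_apply, LinearEquiv.coe_coe]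
  generalize comulBeta σ u = w
  induction w using TensorProduct.induction_on with
  | zero => simp
  | add u v hu hv => simp only [map_add, hu, hv]
  | tmul x y => simp [map_split_symm]

/-- The iterated coproduct is nested to the left, so a cut before the last factor holds by
definition. Coassociativity moves the cut to any other place. -/
theorem split_opPow (hco : (TensorProduct.assoc K _ _ _).toLinearMap ∘ₗ (comulBeta σ).rTensor _ ∘ₗ
      comulBeta σ = (comulBeta σ).lTensor _ ∘ₗ comulBeta σ)
    {a b n : ℕ} (h : a + 1 + (b + 1) = n + 1) :
    (split K V h).toLinearMap ∘ₗ opPow σ M n =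
      map (opPow σ M a) (opPow σ M b) ∘ₗ comulBeta σ := by
  induction b generalizing n with
  | zero =>
    obtain rfl : n = a + 1 := by omega
    rw [opPow_succ]
    exact LinearMap.ext fun u => by simp
  | succ b ih =>
    obtain rfl : n = a + b + 1 + 1 := by omega
    have h₁ : a + 1 + (b + 1) = a + b + 1 + 1 := by omega
    refine LinearMap.ext fun u => ?_
    -- `e₁` and `e₂` express the two sides through the two iterates of `△_β`, nested to the left and
    -- to the right; `hco` identifies these.
    have e₁ : ∀ w, map (opPow σ M (a + b + 1)) (opPow σ M 0) w =
        (split K V h₁).symm.toLinearMap.rTensor _ ((TensorProduct.assoc K _ _ _).symm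
          (map (opPow σ M a) (map (opPow σ M b) (opPow σ M 0))
            (TensorProduct.assoc K _ _ _ ((comulBeta σ).rTensor _ w)))) := fun w => by
      induction w using TensorProduct.induction_on with
      | zero => simp
      | add u v hu hv => simp only [map_add, hu, hv]
      | tmul x y =>
        have e := LinearMap.congr_fun (ih h₁) x
        rw [LinearMap.comp_apply, LinearEquiv.coe_coe, ← LinearEquiv.eq_symm_apply] at e
        rw [map_tmul, e, LinearMap.rTensor_tmul, LinearMap.comp_apply]
        generalize comulBeta σ x = w
        induction w using TensorProduct.induction_on with
        | zero => simp
        | add u v hu hv => simp only [map_add, add_tmul, hu, hv]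
        | tmul x y => simp
    have e₂ : ∀ w, (split K V h).symm (map (opPow σ M a) (opPow σ M (b + 1)) w) =
        (split K V rfl).symm ((split K V h₁).symm.toLinearMap.rTensor _
          ((TensorProduct.assoc K _ _ _).symm (map (opPow σ M a) (map (opPow σ M b) (opPow σ M 0))
            ((comulBeta σ).lTensor _ w)))) := fun w => by
      induction w using TensorProduct.induction_on with
      | zero => simp
      | add u v hu hv => simp only [map_add, hu, hv]
      | tmul x y =>
        simp only [map_tmul, opPow_succ σ M b, LinearMap.lTensor_tmul, LinearMap.comp_apply]
        generalize comulBeta σ y = w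
        induction w using TensorProduct.induction_on with
        | zero => simp
        | add u v hu hv => simp only [map_add, tmul_add, hu, hv]
        | tmul x y =>
          simp only [map_tmul, assoc_symm_tmul, LinearMap.rTensor_tmul, LinearEquiv.coe_coe]
          exact (split_symm_assoc ..).symm
    have hu := LinearMap.congr_fun hco u
    simp only [LinearMap.comp_apply, LinearEquiv.coe_coe] at hu ⊢
    rw [← LinearEquiv.eq_symm_apply, e₂, ← hu, opPow_succ, LinearMap.comp_apply,
      LinearMap.comp_apply, e₁, LinearEquiv.coe_coe]

variable {M}

/-- The summands of `∗` lie in pairwise different degrees, so the projection retains a single one.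
Beyond the range of the finite sum that term vanishes. -/
theorem proj_succ_star (hM : M 0 0 = 0) (n : ℕ) : proj K V (n + 1) ∘ₗ star σ M = opPow σ M n := by
  refine LinearMap.ext fun u => ?_
  obtain ⟨N, h₁, h₂⟩ := star_eq_sum σ M hM u
  rw [LinearMap.comp_apply, h₂, map_add, map_sum, counitTensor, LinearMap.comp_apply, unitMap,
    LinearMap.comp_apply, proj_incl_of_ne (by omega), zero_add]
  by_cases hn : n < N
  · rw [Finset.sum_eq_single n, proj_incl]
    · exact fun m _ hm => proj_incl_of_ne (by omega) _
    · exact fun h => absurd (Finset.mem_range.2 hn) h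
  · rw [h₁ n (by omega)]
    refine Finset.sum_eq_zero fun m hm => proj_incl_of_ne ?_ _
    have := Finset.mem_range.1 hm
    omega

theorem proj_zero_star (hM : M 0 0 = 0) :
    proj K V 0 ∘ₗ star σ M = (powZero K V).symm.toLinearMap ∘ₗ counitMul K V := by
  refine LinearMap.ext fun u => ?_
  obtain ⟨N, h₁, h₂⟩ := star_eq_sum σ M hM u
  rw [LinearMap.comp_apply, h₂, map_add, map_sum, Finset.sum_eq_zero, add_zero]
  · exact proj_incl ..
  · exact fun m _ => proj_incl_of_ne (by omega) _

theorem counit_star (hM : M 0 0 = 0) : counit K V ∘ₗ star σ M = counitMul K V := by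
  have h := congrArg (fun f => (powZero K V).toLinearMap ∘ₗ f) (proj_zero_star σ hM)
  refine Eq.trans h (LinearMap.ext fun u => ?_)
  simp

theorem proj_one_star (hM : M 0 0 = 0) :
    proj K V 1 ∘ₗ star σ M = (powOne K V).symm.toLinearMap ∘ₗ ofComponents M := by
  rw [← opPow_zero σ M, ← proj_succ_star σ hM]

/-- The counit term lives on length `(0, 0)` only. Without it, `∗` has the same shape as the sums in
condition (iii). -/
theorem star_incl₂ (i j : ℕ) (hij : i ≠ 0 ∨ j ≠ 0) : star σ M ∘ₗ incl₂ K V i j =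
    ∑ n ∈ Finset.range (i + j), incl K V (n + 1) ∘ₗ opPow σ M n ∘ₗ incl₂ K V i j := by
  have h : counitTensor K V ∘ₗ incl₂ K V i j = 0 := TensorProduct.ext' fun x y => by
    simp only [counitTensor, LinearMap.comp_apply, map_tmul, LinearEquiv.coe_coe, lid_tmul,
      counit_eq]
    rcases hij with h | h
    · rw [proj_incl_of_ne h]; simp
    · rw [proj_incl_of_ne h]; simp
  rw [star, ofComponents_incl₂, LinearMap.add_comp, h, zero_add]
  exact LinearMap.ext fun u => by simp

end OpPow

/-! ### `∗` as a morphism of Yetter-Drinfeld modules and of coalgebras -/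

section YetterDrinfeld

variable {K H V : Type*} [Field K] [Ring H] [HopfAlgebra K H] [AddCommMonoid V] [Module K V]
  {D : ActCoact K H V} {M : Operations K V}

theorem isMorphism_ofComponents
    (hMor : ∀ p q : ℕ, IsMorphism ((D.pow p).tensor (D.pow q)) D (M p q)) :
    IsMorphism (D.tensorSpace.tensor D.tensorSpace) D (ofComponents M) :=
  isMorphism_of_incl₂ fun i j => by
    rw [ofComponents_incl₂]
    exact hMor i j

theorem isMorphism_opPow (hD : IsYetterDrinfeld D)
    (hMor : ∀ p q : ℕ, IsMorphism ((D.pow p).tensor (D.pow q)) D (M p q)) (n : ℕ) :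
    IsMorphism (D.tensorSpace.tensor D.tensorSpace) (D.pow (n + 1))
      (opPow (naturalBraiding D) M n) := by
  have h₀ : IsMorphism (D.tensorSpace.tensor D.tensorSpace) (D.pow 1)
      (opPow (naturalBraiding D) M 0) := by
    rw [opPow_zero]
    exact (isMorphism_powOne D).symm.comp (isMorphism_ofComponents hMor)
  induction n with
  | zero => exact h₀
  | succ n ih =>
    rw [opPow_succ]
    exact (isMorphism_split D _).symm.comp ((ih.tensor h₀).comp (isMorphism_comulBeta hD))

theorem isMorphism_star (hD : IsYetterDrinfeld D)
    (hMor : ∀ p q : ℕ, IsMorphism ((D.pow p).tensor (D.pow q)) D (M p q)) :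
    IsMorphism (D.tensorSpace.tensor D.tensorSpace) D.tensorSpace
      (star (naturalBraiding D) M) := by
  refine isMorphism_of_incl₂ fun i j => ?_
  rw [star, ofComponents_incl₂]
  refine .comp (.add ?_ (.sum _ fun n _ => (isMorphism_incl D _).comp (isMorphism_opPow hD hMor n)))
    ((isMorphism_incl D i).tensor (isMorphism_incl D j))
  exact (isMorphism_unitMap D).comp ((isMorphism_lid _).comp
    ((isMorphism_counit D).tensor (isMorphism_counit D)))

/-- Compare components of bidegree `(a, b)`. If both are positive, this is the freedom to cut `M^{⊗
n} ∘ △_β^{(n-1)}` anywhere; if one is zero, it is a counit law of `△_β`. -/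
theorem deconcat_star (hD : IsYetterDrinfeld D) (hM : M 0 0 = 0) :
    deconcat K V ∘ₗ star (naturalBraiding D) M =
      map (star (naturalBraiding D) M) (star (naturalBraiding D) M) ∘ₗ
        comulBeta (naturalBraiding D) := by
  refine LinearMap.ext fun u => jointlyInjective_proj.tensor jointlyInjective_proj _ _ ?_
  rintro ⟨a, b⟩
  have e : ∀ w, map (proj K V a) (proj K V b)
      (map (star (naturalBraiding D) M) (star (naturalBraiding D) M) w) =
      map (proj K V a ∘ₗ star (naturalBraiding D) M) (proj K V b ∘ₗ star (naturalBraiding D) M) w :=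
    fun w => by rw [map_comp, LinearMap.comp_apply]
  simp only [LinearMap.comp_apply]
  rw [e]
  rcases a with _ | a
  · rw [map_proj_deconcat (zero_add b), split_zero_left, proj_zero_star _ hM]
    have h := congrArg (map (powZero K V).symm.toLinearMap (proj K V b ∘ₗ star (naturalBraiding D) M))
      (counitMul_comulBeta_left hD u)
    rw [LinearMap.rTensor, ← LinearMap.comp_apply, ← map_comp, LinearMap.comp_id] at h
    exact h.symm
  rcases b with _ | b
  · rw [map_proj_deconcat (add_zero (a + 1)), split_zero_right, proj_zero_star _ hM]
    have h := congrArg (map (proj K V (a + 1) ∘ₗ star (naturalBraiding D) M)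
      (powZero K V).symm.toLinearMap) (counitMul_comulBeta_right hD u)
    rw [LinearMap.lTensor, ← LinearMap.comp_apply, ← map_comp, LinearMap.comp_id] at h
    exact h.symm
  have h : a + 1 + (b + 1) = a + b + 1 + 1 := by omega
  rw [map_proj_deconcat h, ← LinearMap.comp_apply, proj_succ_star _ hM, proj_succ_star _ hM,
    proj_succ_star _ hM]
  exact LinearMap.congr_fun (split_opPow _ M (comulBeta_coassoc hD) h) u

/-! ### The unit of `T(V)` is a unit for `∗` -/

theorem deconcat_unitMap : deconcat K V (unitMap K V 1) = unitMap K V 1 ⊗ₜ unitMap K V 1 := by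
  simp only [unitMap, LinearMap.comp_apply, deconcat, DirectSum.toModule_lof]
  rw [LinearMap.sum_apply, Fin.sum_univ_one]
  simp only [LinearMap.comp_apply, LinearEquiv.coe_coe]
  exact (congrArg (incl₂ K V 0 0) (split_zero_left (zero_add 0) _)).trans (map_tmul ..)

theorem counit_unitMap (r : K) : counit K V (unitMap K V r) = r := by
  rw [counit_eq, unitMap, LinearMap.comp_apply, proj_incl]
  exact (powZero K V).apply_symm_apply r

/-- The unit is grouplike and crosses trivially, so tensoring with it is a coalgebra map from `T(V)`
to its braided square. -/
theorem comulBeta_unitMap_left (hD : IsYetterDrinfeld D) (t : TensorSpace K V) :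
    comulBeta (naturalBraiding D) (unitMap K V 1 ⊗ₜ t) =
      map (TensorProduct.mk K _ _ (unitMap K V 1)) (TensorProduct.mk K _ _ (unitMap K V 1))
        (deconcat K V t) := by
  rw [comulBeta_eq_tensorComul hD, tensorComul, LinearMap.comp_apply, map_tmul, deconcat_unitMap]
  generalize deconcat K V t = w
  induction w using TensorProduct.induction_on with
  | zero => simp
  | add u v hu hv => simp only [map_add, tmul_add, hu, hv]
  | tmul x y =>
    have h := braid_map (isMorphism_unitMap D) (IsMorphism.id (D := D.tensorSpace)) (1 ⊗ₜ x)
    rw [map_tmul, braid_unit_left hD.tensorSpace, map_tmul] at h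
    rw [braidMid_tmul, ← LinearMap.id_apply (R := K) x, h]
    rfl

theorem comulBeta_unitMap_right (hD : IsYetterDrinfeld D) (t : TensorSpace K V) :
    comulBeta (naturalBraiding D) (t ⊗ₜ unitMap K V 1) =
      map ((TensorProduct.mk K _ _).flip (unitMap K V 1))
        ((TensorProduct.mk K _ _).flip (unitMap K V 1)) (deconcat K V t) := by
  rw [comulBeta_eq_tensorComul hD, tensorComul, LinearMap.comp_apply, map_tmul, deconcat_unitMap]
  generalize deconcat K V t = w
  induction w using TensorProduct.induction_on with
  | zero => simp
  | add u v hu hv => simp only [map_add, add_tmul, hu, hv]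
  | tmul x y =>
    have h := braid_map (IsMorphism.id (D := D.tensorSpace)) (isMorphism_unitMap D) (y ⊗ₜ 1)
    rw [map_tmul, braid_unit_right hD.tensorSpace, map_tmul] at h
    rw [braidMid_tmul, ← LinearMap.id_apply (R := K) y, h]
    rfl

variable {σ : V ⊗[K] V →ₗ[K] V ⊗[K] V}

theorem ofComponents_incl {X : Type*} [AddCommMonoid X] [Module K X]
    (f : ∀ i j : ℕ, ⨂[K]^i V ⊗[K] ⨂[K]^j V →ₗ[K] X) {i j : ℕ} (x : ⨂[K]^i V) (y : ⨂[K]^j V) :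
    ofComponents f (incl K V i x ⊗ₜ incl K V j y) = f i j (x ⊗ₜ y) :=
  LinearMap.congr_fun (ofComponents_incl₂ f i j) (x ⊗ₜ y)

theorem powZero_symm_one_eq_tprod :
    (powZero K V).symm 1 = PiTensorProduct.tprod K (fun i : Fin 0 => i.elim0) := by
  rw [LinearEquiv.symm_apply_eq]
  exact (PiTensorProduct.isEmptyEquiv_apply_tprod ..).symm

theorem incl_zero_eq_smul (x : ⨂[K]^0 V) : incl K V 0 x = powZero K V x • unitMap K V 1 := by
  obtain ⟨r, rfl⟩ := (powZero K V).symm.surjective x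
  rw [← map_smul, LinearEquiv.apply_symm_apply, smul_eq_mul, mul_one]
  rfl

/-- This is condition (i) for the operations `M_{0n}`: only `M_{01}` survives, and it is the
identity. -/
theorem IsQuantumMultiBrace.ofComponents_unitMap_left (hM : IsQuantumMultiBrace σ M)
    (t : TensorSpace K V) :
    ofComponents M (unitMap K V 1 ⊗ₜ t) = powOne K V (proj K V 1 t) := by
  change ofComponents M (incl K V 0 ((powZero K V).symm 1) ⊗ₜ t) = _
  induction t using tensorSpace_induction with
  | zero => simp
  | add s t hs ht => simp only [map_add, tmul_add, hs, ht]
  | incl n x =>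
  rw [ofComponents_incl]
  match n, x with
  | 0, x => rw [hM.zero_zero, proj_incl_of_ne (by omega), LinearMap.zero_apply, map_zero]
  | 1, x =>
    rw [proj_incl, powZero_symm_one_eq_tprod]
    induction x using PiTensorProduct.induction_on with
    | add u v hu hv => simp only [map_add, tmul_add, hu, hv]
    | smul_tprod r x => rw [tmul_smul, map_smul, hM.zero_one, map_smul, powOne_tprod]
  | n + 2, x =>
    rw [hM.right_zero _ (by omega), proj_incl_of_ne (by omega), LinearMap.zero_apply, map_zero]

theorem IsQuantumMultiBrace.ofComponents_unitMap_right (hM : IsQuantumMultiBrace σ M)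
    (t : TensorSpace K V) :
    ofComponents M (t ⊗ₜ unitMap K V 1) = powOne K V (proj K V 1 t) := by
  change ofComponents M (t ⊗ₜ incl K V 0 ((powZero K V).symm 1)) = _
  induction t using tensorSpace_induction with
  | zero => simp
  | add s t hs ht => simp only [map_add, add_tmul, hs, ht]
  | incl n x =>
  rw [ofComponents_incl]
  match n, x with
  | 0, x => rw [hM.zero_zero, proj_incl_of_ne (by omega), LinearMap.zero_apply, map_zero]
  | 1, x =>
    rw [proj_incl, powZero_symm_one_eq_tprod]
    induction x using PiTensorProduct.induction_on with
    | add u v hu hv => simp only [map_add, add_tmul, hu, hv]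
    | smul_tprod r x => rw [← smul_tmul', map_smul, hM.one_zero, map_smul, powOne_tprod]
  | n + 2, x =>
    rw [hM.left_zero _ (by omega), proj_incl_of_ne (by omega), LinearMap.zero_apply, map_zero]

/-- Multiplication by the unit and the identity are coalgebra endomorphisms of `T(V)` with the same
components in degrees `0` and `1`. -/
theorem unitMap_star (hD : IsYetterDrinfeld D) (hM : IsQuantumMultiBrace (naturalBraiding D) M)
    (t : TensorSpace K V) : star (naturalBraiding D) M (unitMap K V 1 ⊗ₜ t) = t := by
  refine LinearMap.congr_fun (coalgebraMap_ext (Δ := deconcat K V)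
    (f := star (naturalBraiding D) M ∘ₗ TensorProduct.mk K _ _ (unitMap K V 1)) (g := .id)
    ?_ (by simp) ?_ ?_) t
  · rw [← LinearMap.comp_assoc, deconcat_star hD hM.zero_zero, map_comp, LinearMap.comp_assoc,
      LinearMap.comp_assoc]
    exact congrArg _ (LinearMap.ext (comulBeta_unitMap_left hD))
  · rw [← LinearMap.comp_assoc, proj_zero_star _ hM.zero_zero]
    refine LinearMap.ext fun t => ?_
    simp [counitMul, counit_unitMap]
    simp [counit_eq]
  · rw [← LinearMap.comp_assoc, proj_one_star _ hM.zero_zero]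
    refine LinearMap.ext fun t => ?_
    simp [hM.ofComponents_unitMap_left]

theorem star_unitMap (hD : IsYetterDrinfeld D) (hM : IsQuantumMultiBrace (naturalBraiding D) M)
    (t : TensorSpace K V) : star (naturalBraiding D) M (t ⊗ₜ unitMap K V 1) = t := by
  refine LinearMap.congr_fun (coalgebraMap_ext (Δ := deconcat K V)
    (f := star (naturalBraiding D) M ∘ₗ (TensorProduct.mk K _ _).flip (unitMap K V 1)) (g := .id)
    ?_ (by simp) ?_ ?_) t
  · rw [← LinearMap.comp_assoc, deconcat_star hD hM.zero_zero, map_comp, LinearMap.comp_assoc,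
      LinearMap.comp_assoc]
    exact congrArg _ (LinearMap.ext (comulBeta_unitMap_right hD))
  · rw [← LinearMap.comp_assoc, proj_zero_star _ hM.zero_zero]
    refine LinearMap.ext fun t => ?_
    simp [counitMul, counit_unitMap]
    simp [counit_eq]
  · rw [← LinearMap.comp_assoc, proj_one_star _ hM.zero_zero]
    refine LinearMap.ext fun t => ?_
    simp [hM.ofComponents_unitMap_right]

/-- The associativity of `∗` in degree one. -/
theorem ofComponents_star (hD : IsYetterDrinfeld D)
    (hM : IsQuantumMultiBrace (naturalBraiding D) M) (x y z : TensorSpace K V) :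
    ofComponents M (star (naturalBraiding D) M (x ⊗ₜ y) ⊗ₜ z) =
      ofComponents M (x ⊗ₜ star (naturalBraiding D) M (y ⊗ₜ z)) := by
  have h₁ : ∀ u, powOne K V (proj K V 1 (star (naturalBraiding D) M u)) = ofComponents M u :=
    fun u => by
      rw [← LinearMap.comp_apply, proj_one_star _ hM.zero_zero]
      exact LinearEquiv.apply_symm_apply ..
  induction x using tensorSpace_induction with
  | zero => simp
  | add s t hs ht => simp only [map_add, add_tmul, hs, ht]
  | incl i x =>
  induction y using tensorSpace_induction with
  | zero => simp
  | add s t hs ht => simp only [map_add, tmul_add, add_tmul, hs, ht]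
  | incl j y =>
  induction z using tensorSpace_induction with
  | zero => simp
  | add s t hs ht => simp only [map_add, tmul_add, hs, ht]
  | incl k z =>
  -- Condition (iii) covers positive lengths only. A tensor of length zero is a scalar multiple of
  -- the unit, so the unit laws settle the other cases.
  rcases Nat.eq_zero_or_pos i with rfl | hi
  · rw [incl_zero_eq_smul, ← smul_tmul', ← smul_tmul', map_smul, map_smul, ← smul_tmul', map_smul,
      unitMap_star hD hM, hM.ofComponents_unitMap_left, h₁]
  rcases Nat.eq_zero_or_pos j with rfl | hj
  · rw [incl_zero_eq_smul, ← smul_tmul', tmul_smul, map_smul, map_smul, ← smul_tmul', tmul_smul,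
      unitMap_star hD hM, star_unitMap hD hM]
  rcases Nat.eq_zero_or_pos k with rfl | hk
  · rw [incl_zero_eq_smul, tmul_smul, tmul_smul, map_smul, map_smul, tmul_smul, map_smul,
      star_unitMap hD hM, hM.ofComponents_unitMap_right, h₁]
  have h := LinearMap.congr_fun (hM.assoc i j k hi hj hk) ((x ⊗ₜ y) ⊗ₜ z)
  have e₁ := LinearMap.congr_fun (star_incl₂ (naturalBraiding D) (M := M) i j (.inl hi.ne'))
    (x ⊗ₜ y)
  have e₂ := LinearMap.congr_fun (star_incl₂ (naturalBraiding D) (M := M) j k (.inl hj.ne'))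
    (y ⊗ₜ z)
  simp only [LinearMap.comp_apply, map_tmul, LinearMap.sum_apply] at e₁ e₂
  rw [e₁, e₂, sum_tmul, tmul_sum, map_sum, map_sum]
  simp only [ofComponents_incl]
  simpa only [LinearMap.sum_apply, LinearMap.comp_apply, LinearMap.rTensor_tmul, map_tmul,
    LinearMap.lTensor_tmul, LinearEquiv.coe_coe, assoc_tmul] using h

/-- Both bracketings are coalgebra maps from the threefold braided tensor product to `T(V)`, so only
degrees `0` and `1` have to be compared. -/
theorem star_assoc (hD : IsYetterDrinfeld D) (hM : IsQuantumMultiBrace (naturalBraiding D) M)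
    (hMor : ∀ p q : ℕ, IsMorphism ((D.pow p).tensor (D.pow q)) D (M p q)) :
    star (naturalBraiding D) M ∘ₗ (star (naturalBraiding D) M).rTensor _ =
      (star (naturalBraiding D) M ∘ₗ (star (naturalBraiding D) M).lTensor _) ∘ₗ
        (TensorProduct.assoc K _ _ _).toLinearMap := by
  have hT := hD.tensorSpace
  have hs := isMorphism_star hD hMor
  have hδ := deconcat_star hD hM.zero_zero
  have hβ := comulBeta_eq_tensorComul hD
  -- The source carries the coproduct of the left bracketing.
  refine coalgebraMap_ext (Δ := tensorComul (D.tensorSpace.tensor D.tensorSpace) D.tensorSpace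
    (comulBeta (naturalBraiding D)) (deconcat K V)) ?_ ?_ ?_ ?_
  · have h := tensorComul_map hs (IsMorphism.id (D := D.tensorSpace)) hδ
      (show deconcat K V ∘ₗ .id = map .id .id ∘ₗ deconcat K V by simp)
    rw [← hβ] at h
    rw [← LinearMap.comp_assoc, hδ, LinearMap.comp_assoc, map_comp, LinearMap.comp_assoc]
    exact congrArg _ h
  · have h := tensorComul_map (IsMorphism.id (D := D.tensorSpace)) hs
      (show deconcat K V ∘ₗ .id = map .id .id ∘ₗ deconcat K V by simp) hδ
    -- The map `id ⊗ ∗` respects the coproduct of the right bracketing, and the associator carries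
    -- the chosen coproduct to that one.
    have h' := tensorComul_assoc (ΔX := deconcat K V) (ΔY := deconcat K V) (ΔZ := deconcat K V)
      (E := D.tensorSpace) hT hT
    rw [← hβ] at h h'
    rw [← LinearMap.comp_assoc, ← LinearMap.comp_assoc, hδ, LinearMap.comp_assoc, map_comp,
      map_comp, LinearMap.comp_assoc, LinearMap.comp_assoc, h']
    exact congrArg (fun f => map (star (naturalBraiding D) M) (star (naturalBraiding D) M) ∘ₗ
      f ∘ₗ (TensorProduct.assoc K _ _ _).toLinearMap) h
  -- Degree `0`: the counit is multiplicative for `∗`, so both sides are the product of three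
  -- counits.
  · rw [← LinearMap.comp_assoc, ← LinearMap.comp_assoc, ← LinearMap.comp_assoc,
      proj_zero_star _ hM.zero_zero]
    have hc : ∀ u, counit K V (star (naturalBraiding D) M u) = counitMul K V u :=
      LinearMap.congr_fun (counit_star _ hM.zero_zero)
    refine TensorProduct.ext_threefold fun x y z => ?_
    simp only [LinearMap.comp_apply, LinearMap.rTensor_tmul, LinearEquiv.coe_coe, assoc_tmul,
      LinearMap.lTensor_tmul]
    simp [counitMul, hc, mul_assoc]
  -- Degree `1`: condition (iii), extended to all lengths by `ofComponents_star`.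
  · rw [← LinearMap.comp_assoc, ← LinearMap.comp_assoc, ← LinearMap.comp_assoc,
      proj_one_star _ hM.zero_zero]
    refine TensorProduct.ext_threefold fun x y z => ?_
    simp only [LinearMap.comp_apply, LinearMap.rTensor_tmul, LinearEquiv.coe_coe, assoc_tmul,
      LinearMap.lTensor_tmul, ofComponents_star hD hM]

end YetterDrinfeld

end QMB

theorem proposition3p7 {K H V : Type*} [Field K] [Ring H] [HopfAlgebra K H]
    [AddCommGroup V] [Module K V]
    (D : QMB.ActCoact K H V) (hD : QMB.IsYetterDrinfeld D)
    (M : QMB.Operations K V)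
    (hM : QMB.IsQuantumMultiBrace (QMB.naturalBraiding D) M)
    (hMor : ∀ p q : ℕ, QMB.IsMorphism ((D.pow p).tensor (D.pow q)) D (M p q)) :
    QMB.IsYDAlgebra D.tensorSpace (QMB.star (QMB.naturalBraiding D) M) where
  isYetterDrinfeld := hD.tensorSpace
  assoc x y z := LinearMap.congr_fun (QMB.star_assoc hD hM hMor) ((x ⊗ₜ y) ⊗ₜ z)
  isMorphism := QMB.isMorphism_star hD hMor
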